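/- Let $k$ be a field of characteristic zero. A standard graded artinian algebra is $A=R/I$, where $R=k[x_1,\dots,x_r]$ and $I$ is a homogeneous ideal containing no nonzero linear form, with $\dim_k A<\infty$. Its $h$-vector is $h=(h_0,h_1,\dots,h_e)$, where $h_j=\dim_k A_j$ and the socle degree $e$ is the last index with $A_e\neq 0$; its codimension is $r=h_1$. The algebra $A$ is level of type $2$ if its socle (the annihilator of the ideal generated by the classes of the variables) is concentrated in degree $e$ and has dimension $2$; then $h_e=2$. A level $h$-vector of type $2$ is the $h$-vector of such an algebra; we write it as $(1,r,\dots,a,2)$, where $a=h_{e-1}$. Let $r\ge 2$ and $e\ge 4$ be integers. (i) Suppose $r\le 5$ and $2\le i\le e-2$. If $h=(1,r,\dots,h_{e-i},\dots,r,2)$ is a level $h$-vector of type $2$ and socle degree $e$ (so $a=r$), then $$h_{e-i}=h_i\le \min\left\{\binom{r-2+i}{i}+1,\ \binom{r-2+e-i}{e-i}+1\right\}.$$ Conversely, for every integer $v$ between $r$ and this minimum (inclusive) there is a level $h$-vector of type $2$ and socle degree $e$ of the form $(1,r,\dots,h_{e-i},\dots,r,2)$ with $h_{e-i}=v$. (ii)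 Suppose $r<a\le 2r$ and $2\le i\le e-2$. If $h=(1,r,\dots,h_{e-i},\dots,a,2)$ is a level $h$-vector of type $2$ and socle degree $e$, then $$h_{e-i}\le \min\left\{\binom{r-1+i}{i}+\binom{a-r-1+i}{i},\ \binom{r-1+e-i}{e-i}\right\}.$$ Conversely, for every integer $v$ between $a$ and this minimum (inclusive) there is a level $h$-vector of type $2$ and socle degree $e$ of the form $(1,r,\dots,h_{e-i},\dots,a,2)$ with $h_{e-i}=v$. (iii) Let $r\le a\le 2r$, and assume $r\le 5$ if $a=r$. Then all the upper bounds above are attained simultaneously: the vector $H=(1,r,H_2,\dots,H_{e-2},a,2)$, in which $H_{e-i}$ equals the upper bound for $h_{e-i}$ given in (i) (if $a=r$) or in (ii) (if $a>r$) for every $i=2,\dots,e-2$, is itself a level $h$-vector, and it is the entry by entry maximum of all level $h$-vectors of type $2$ and socle degree $e$ of the form $(1,r,\dots,a,2)$. -/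

import Mathlib

open MvPolynomial

noncomputable section

namespace LevelAlg

attribute [local instance] MvPolynomial.gradedAlgebra

variable {k : Type*} [Field k] {r : ℕ}

/-- The degree `d` component `A_d` of `A = k[x_1, …, x_r] / I`. -/
def gradedPiece (I : Ideal (MvPolynomial (Fin r) k)) (d : ℕ) :
    Submodule k (MvPolynomial (Fin r) k ⧸ I) :=
  (homogeneousSubmodule (Fin r) k d).map (Ideal.Quotient.mkₐ k I).toLinearMap

/-- The `h`-vector `d ↦ dim_k A_d` of `A = k[x_1, …, x_r] / I`, extended by zero beyond the last
nonzero entry. -/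
def hVector (I : Ideal (MvPolynomial (Fin r) k)) (d : ℕ) : ℕ :=
  Module.finrank k (gradedPiece I d)

/-- The ideal of `A = k[x_1, …, x_r] / I` generated by the classes of the variables. -/
def maxHomIdeal (I : Ideal (MvPolynomial (Fin r) k)) : Ideal (MvPolynomial (Fin r) k ⧸ I) :=
  Ideal.span (Set.range fun j : Fin r => Ideal.Quotient.mk I (X j))

/-- The socle of `A`: the annihilator of the maximal homogeneous ideal. -/
def socle (I : Ideal (MvPolynomial (Fin r) k)) : Ideal (MvPolynomial (Fin r) k ⧸ I) :=
  Submodule.annihilator (maxHomIdeal I)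

/-- The socle-vector `d ↦ dim_k soc(A)_d`. -/
def socleVector (I : Ideal (MvPolynomial (Fin r) k)) (d : ℕ) : ℕ :=
  Module.finrank k ((socle I).restrictScalars k ⊓ gradedPiece I d : Submodule k _)

/-- `A = k[x_1, …, x_r] / I` is a standard graded artinian algebra of codimension `r`
and socle degree `e` (the last index with `A_e ≠ 0`). -/
structure IsGradedArtinian (I : Ideal (MvPolynomial (Fin r) k)) (e : ℕ) : Prop where
  homogeneous : I.IsHomogeneous (homogeneousSubmodule (Fin r) k)
  artinian : IsArtinianRing (MvPolynomial (Fin r) k ⧸ I)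
  /-- `I` contains no nonzero linear form, that is, `h_1 = r`. -/
  no_linear_form : ∀ f ∈ I, f.IsHomogeneous 1 → f = 0
  top_ne_zero : hVector I e ≠ 0
  eq_zero_above : ∀ d, e < d → hVector I d = 0

/-- `A = k[x_1, …, x_r] / I` is a level algebra of codimension `r`, socle degree `e` and type `t`:
its socle-vector is `(0, …, 0, t)`, with `t` in degree `e`. -/
structure IsLevel (I : Ideal (MvPolynomial (Fin r) k)) (e t : ℕ) : Prop
    extends IsGradedArtinian I e where
  socleVector_eq : ∀ d, socleVector I d = if d = e then t else 0

end LevelAlg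

/-- `h` is the `h`-vector of a level algebra over `k` of codimension `r`, socle degree `e`
and type `t`. -/
def IsLevelHVector (k : Type*) [Field k] (r e t : ℕ) (h : ℕ → ℕ) : Prop :=
  ∃ I : Ideal (MvPolynomial (Fin r) k), LevelAlg.IsLevel I e t ∧ LevelAlg.hVector I = h

/-- The upper bound for the entry `h_{e-i}` of a level `h`-vector `(1, r, …, a, 2)` of socle
degree `e`. -/
def entryBound (r a e i : ℕ) : ℕ :=
  if a = r then
    min ((r - 2 + i).choose i + 1) ((r - 2 + (e - i)).choose (e - i) + 1)
  else
    min ((r - 1 + i).choose i + (a - r - 1 + i).choose i) ((r - 1 + (e - i)).choose (e - i))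

/-- The vector `(1, r, h_2, …, h_{e-2}, a, 2)` in which `h_{e-i}` is the upper bound for each
`2 ≤ i ≤ e - 2`, extended by zero beyond degree `e`. -/
def maxHVector (r a e : ℕ) (j : ℕ) : ℕ :=
  if j = 0 then 1
  else if j = 1 then r
  else if j + 2 ≤ e then entryBound r a e (e - j)
  else if j + 1 = e then a
  else if j = e then 2
  else 0

end

/-!
By Macaulay duality, the level algebras of type 2 and socle degree `e` correspond to the planes
`W = ⟨F, G⟩` of functionals on the forms of degree `e`, and `h (e - i) = dim (R_i • W)`.

If `a > r`, put `s = dim (R_1 • F)`. Then `R_i • F` and `(R_i • W) / (R_i • F)` have at most the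
dimensions of the spaces of forms of degree `i` in `s` and in `a - s` variables, and convexity
allows one to replace `s` by `r`.

If `a = r ≤ 5`, either some member `F'` of the pencil is annihilated by no linear form, so that
`R_1 • G ≤ R_1 • F'` by a dimension count, or the linear forms annihilating the members of the
pencil show that `R_i • W` exceeds `R_i • F'` by at most one dimension. In both cases `h` is the
symmetric Hilbert function of the Gorenstein algebra of `F'` plus a constant `0` or `1`.

Conversely, adding to `F` a multiple of the evaluation at a general point raises the dimensions of
the spaces `N + R_i • F` one at a time, up to their maximal values. The second generator `G` is
taken in `a - r` of the variables if `a > r`, and as the evaluation at a coordinate point outside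
the variables of `F` if `a = r`.
-/

noncomputable section

namespace LevelAlg

open Module Submodule MvPolynomial

attribute [local instance] MvPolynomial.gradedAlgebra

/-! ### Pencils of linear maps -/

section LinearAlgebra

variable {k M N : Type*} [Field k] [AddCommGroup M] [Module k M] [AddCommGroup N] [Module k N]

theorem finrank_map_add_finrank_inf_ker (f : M →ₗ[k] N) (S : Submodule k M)
    [FiniteDimensional k S] :
    finrank k (S.map f) + finrank k (S ⊓ LinearMap.ker f : Submodule k M) = finrank k S := by
  rw [← LinearMap.range_domRestrict, ← LinearMap.finrank_range_add_finrank_ker (f.domRestrict S),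
    LinearMap.ker_domRestrict, ← finrank_map_subtype_eq S (comap S.subtype (LinearMap.ker f)),
    map_comap_subtype]

theorem finrank_map_mkQ_add_finrank (S Q : Submodule k M) [FiniteDimensional k S]
    [FiniteDimensional k Q] :
    finrank k (S.map Q.mkQ) + finrank k Q = finrank k (S ⊔ Q : Submodule k M) := by
  have h := finrank_map_add_finrank_inf_ker Q.mkQ (S ⊔ Q)
  rwa [ker_mkQ, inf_eq_right.2 le_sup_right, Submodule.map_sup, mkQ_map_self, sup_bot_eq] at h

theorem exists_sup_eq_finrank_add {V K : Submodule k M} [FiniteDimensional k V] (hK : K ≤ V) :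
    ∃ T ≤ V, K ⊔ T = V ∧ finrank k K + finrank k T = finrank k V := by
  obtain ⟨T, hKT, hsup⟩ := IsModularLattice.exists_disjoint_and_sup_eq hK
  have hT : T ≤ V := hsup ▸ le_sup_right
  have := finiteDimensional_of_le hK
  have := finiteDimensional_of_le hT
  refine ⟨T, hT, hsup, ?_⟩
  rw [← finrank_sup_add_finrank_inf_eq, hKT.eq_bot, finrank_bot, add_zero, hsup]

instance (S : Submodule k M) (T : Submodule k N) [FiniteDimensional k S]
    [FiniteDimensional k T] : FiniteDimensional k (S.prod T) :=
  Finite.iff_fg.2 (FG.prod (Finite.iff_fg.1 inferInstance) (Finite.iff_fg.1 inferInstance))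

theorem finrank_prod_submodule (S : Submodule k M) (T : Submodule k N) [FiniteDimensional k S]
    [FiniteDimensional k T] : finrank k (S.prod T) = finrank k S + finrank k T := by
  have h : S.prod T = LinearMap.range (S.subtype.prodMap T.subtype) := by
    rw [LinearMap.range_prodMap, range_subtype, range_subtype]
  rw [h, LinearMap.finrank_range_of_inj
    (S.subtype_injective.prodMap T.subtype_injective), finrank_prod]

theorem exists_span_pair_eq_of_finrank_eq_two {W : Submodule k M} (hW : finrank k W = 2) :
    ∃ x ∈ W, ∃ y ∈ W, span k {x, y} = W := by
  have := Module.finite_of_finrank_pos (hW ▸ two_pos)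
  have := Module.Free.of_divisionRing k W
  let b := finBasisOfFinrankEq k W hW
  refine ⟨b 0, (b 0).2, b 1, (b 1).2, ?_⟩
  have hb := congrArg (Submodule.map W.subtype) b.span_eq
  rw [Submodule.map_span, Submodule.map_top, range_subtype, ← Set.range_comp] at hb
  refine (congrArg (span k) ?_).trans hb
  ext z
  simp [Fin.exists_fin_two, eq_comm]

theorem finrank_span_singleton_le (y : M) : finrank k (k ∙ y) ≤ 1 :=
  (finrank_span_le_card _).trans (by simp)

instance (x y : M) : FiniteDimensional k (span k {x, y}) :=
  FiniteDimensional.span_of_finite k (Set.toFinite _)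

theorem span_pair_add_smul (x y : M) (c : k) : span k {x + c • y, y} = span k {x, y} := by
  apply le_antisymm <;> rw [span_le] <;> rintro _ (rfl | rfl)
  · exact mem_span_pair.2 ⟨1, c, by module⟩
  · exact mem_span_pair.2 ⟨0, 1, by module⟩
  · exact mem_span_pair.2 ⟨1, -c, by module⟩
  · exact mem_span_pair.2 ⟨0, 1, by module⟩

theorem finrank_lt_finrank_sup_span {A : Submodule k M} [FiniteDimensional k A] {z : M}
    (hz : z ∉ A) : finrank k A < finrank k (A ⊔ k ∙ z : Submodule k M) :=
  finrank_lt_finrank_of_lt (left_lt_sup.2 fun h => hz (h (mem_span_singleton_self z)))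

theorem finrank_sup_span_singleton_le (A : Submodule k M) [FiniteDimensional k A] (z : M) :
    finrank k (A ⊔ k ∙ z : Submodule k M) ≤ finrank k A + 1 :=
  (finrank_add_le_finrank_add_finrank _ _).trans
    (Nat.add_le_add_left (finrank_span_singleton_le z) _)

theorem finrank_sup_span_singleton_of_notMem {A : Submodule k M} [FiniteDimensional k A] {z : M}
    (hz : z ∉ A) : finrank k (A ⊔ k ∙ z : Submodule k M) = finrank k A + 1 :=
  (finrank_sup_span_singleton_le A z).antisymm (finrank_lt_finrank_sup_span hz)

theorem finrank_span_pair {x y : M} (hx : x ≠ 0) (hy : y ∉ k ∙ x) :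
    finrank k (span k {x, y}) = 2 := by
  rw [span_insert, finrank_sup_span_singleton_of_notMem hy, finrank_span_singleton hx]

theorem exists_sup_span_singleton_eq {V A : Submodule k M} [FiniteDimensional k V] (hAV : A < V)
    (h : finrank k V ≤ finrank k A + 1) : ∃ z, A ⊔ k ∙ z = V := by
  have := finiteDimensional_of_le hAV.le
  obtain ⟨z, hzV, hzA⟩ := SetLike.exists_of_lt hAV
  exact ⟨z, eq_of_le_of_finrank_le (sup_le hAV.le (by simpa using hzV))
    (h.trans (finrank_lt_finrank_sup_span hzA))⟩

theorem eq_span_singleton_of_finrank_le_one {Q : Submodule k M} (hQ : finrank k Q ≤ 1)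
    [FiniteDimensional k Q] {y : M} (hy : y ∈ Q) (hy0 : y ≠ 0) : Q = k ∙ y :=
  (eq_of_le_of_finrank_le (by simpa using hy) (hQ.trans (finrank_span_singleton hy0).ge)).symm

theorem exists_finset_span_image_compl_eq {ι : Type*} {V : Submodule k M} [FiniteDimensional k V]
    {x : ι → M} (hx : ∀ c, x c ∈ V) :
    ∃ s : Finset ι, ∀ t : Finset ι, s ⊆ t →
      span k (x '' {c | c ∉ t}) = span k (x '' {c | c ∉ s}) := by
  have hfin (t : Finset ι) : FiniteDimensional k (span k (x '' {c | c ∉ t})) :=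
    finiteDimensional_of_le (span_le.2 (by rintro _ ⟨c, -, rfl⟩; exact hx c) : _ ≤ V)
  obtain ⟨s, -, hs⟩ := (measure fun t : Finset ι =>
    finrank k (span k (x '' {c | c ∉ t}))).wf.has_min Set.univ ⟨∅, trivial⟩
  have := hfin s
  exact ⟨s, fun t ht => eq_of_le_of_finrank_le
    (span_mono (Set.image_mono fun c hc hcs => hc (ht hcs))) (not_lt.1 (hs t trivial))⟩

variable {f g : M →ₗ[k] N}

theorem linearIndependent_of_mem_ker_pencil (hfg : Disjoint (LinearMap.ker f) (LinearMap.ker g))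
    {c d : k} (hcd : c ≠ d) {x y : M} (hx0 : x ≠ 0) (hy0 : y ≠ 0)
    (hx : x ∈ LinearMap.ker (f + c • g)) (hy : y ∈ LinearMap.ker (f + d • g)) :
    LinearIndependent k ![x, y] := by
  simp only [LinearMap.mem_ker, LinearMap.add_apply, LinearMap.smul_apply] at hx hy
  have hgy : g y ≠ 0 := fun h => hy0 (disjoint_def.1 hfg y (by simpa [h] using hy) h)
  refine LinearIndependent.pair_iff.2 fun a b hab => ?_
  have hb : (b * (c - d)) • g y = 0 := by
    calc (b * (c - d)) • g y
        = (f (a • x + b • y) + c • g (a • x + b • y)) - a • (f x + c • g x)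
            - b • (f y + d • g y) := by simp only [map_add, map_smul]; module
      _ = 0 := by simp [hab, hx, hy]
  have hb0 : b = 0 :=
    (mul_eq_zero.1 ((smul_eq_zero.1 hb).resolve_right hgy)).resolve_right (sub_ne_zero.2 hcd)
  rw [hb0, zero_smul, add_zero] at hab
  exact ⟨(smul_eq_zero.1 hab).resolve_right hx0, hb0⟩

theorem map_mem_span_singleton_of_mem_ker_pencil
    (hfg : Disjoint (LinearMap.ker f) (LinearMap.ker g)) {c d e : k} (hec : e ≠ c) (hed : e ≠ d)
    {x y : M} {a b : k} (hy0 : y ≠ 0) (hz0 : a • x + b • y ≠ 0)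
    (hx : x ∈ LinearMap.ker (f + c • g)) (hy : y ∈ LinearMap.ker (f + d • g))
    (hz : a • x + b • y ∈ LinearMap.ker (f + e • g)) : g x ∈ k ∙ g y := by
  have hzy := linearIndependent_of_mem_ker_pencil hfg hed hz0 hy0 hz hy
  simp only [LinearMap.mem_ker, LinearMap.add_apply, LinearMap.smul_apply,
    add_eq_zero_iff_eq_neg] at hx hy hz
  have hrel : (a * (e - c)) • g x = (b * (d - e)) • g y := by
    simp only [map_add, map_smul, hx, hy] at hz
    refine sub_eq_zero.1 (Eq.trans ?_ (sub_eq_zero.2 hz))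
    module
  have ha : a * (e - c) ≠ 0 := by
    refine mul_ne_zero ?_ (sub_ne_zero.2 hec)
    rintro rfl
    exact one_ne_zero (LinearIndependent.pair_iff.1 hzy 1 (-b) (by module)).1
  exact mem_span_singleton.2
    ⟨(a * (e - c))⁻¹ * (b * (d - e)), by rw [mul_smul, ← hrel, inv_smul_smul₀ ha]⟩

/- If all members of the pencil were singular, kernel vectors of two of them would form a basis and
those of a third one would make the images of this basis under `g` proportional. -/
theorem exists_ker_pencil_eq_bot [Infinite k] [FiniteDimensional k M]
    (hfg : Disjoint (LinearMap.ker f) (LinearMap.ker g)) (hM : finrank k M ≤ 2)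
    (hle : finrank k M ≤ finrank k (LinearMap.range f ⊔ LinearMap.range g : Submodule k N))
    (s : Finset k) : ∃ c ∉ s, LinearMap.ker (f + c • g) = ⊥ := by
  classical
  by_contra! hcon
  have hker : ∀ c ∉ s, ∃ x ∈ LinearMap.ker (f + c • g), x ≠ 0 := fun c hc =>
    exists_mem_ne_zero_of_ne_bot (hcon c hc)
  obtain ⟨c, hc⟩ := Infinite.exists_notMem_finset s
  obtain ⟨d, hd⟩ := Infinite.exists_notMem_finset (insert c s)
  obtain ⟨e, he⟩ := Infinite.exists_notMem_finset (insert d (insert c s))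
  simp only [Finset.mem_insert, not_or] at hd he
  obtain ⟨x, hx, hx0⟩ := hker c hc
  obtain ⟨y, hy, hy0⟩ := hker d hd.2
  obtain ⟨z, hz, hz0⟩ := hker e he.2.2
  have hxy := linearIndependent_of_mem_ker_pencil hfg (Ne.symm hd.1) hx0 hy0 hx hy
  have hM2 : finrank k M = 2 := hM.antisymm (by simpa using hxy.fintype_card_le_finrank)
  have hspan : span k {x, y} = ⊤ := by
    rw [Set.pair_comm]
    simpa using hxy.span_eq_top_of_card_eq_finrank' (by simp [hM2])
  obtain ⟨a, b, rfl⟩ := mem_span_pair.1 (hspan ▸ mem_top : z ∈ span k {x, y})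
  have hgx := map_mem_span_singleton_of_mem_ker_pencil hfg he.2.1 he.1 hy0 hz0 hx hy hz
  have hgy : g y ∈ k ∙ g y := mem_span_singleton_self _
  simp only [LinearMap.mem_ker, LinearMap.add_apply, LinearMap.smul_apply,
    add_eq_zero_iff_eq_neg] at hx hy
  have hrange : LinearMap.range f ⊔ LinearMap.range g ≤ k ∙ g y := by
    simp only [LinearMap.range_eq_map, ← hspan, Submodule.map_span, Set.image_pair, hx, hy]
    simp only [sup_le_iff, span_le, Set.insert_subset_iff, Set.singleton_subset_iff,
      SetLike.mem_coe]
    exact ⟨⟨neg_mem (smul_mem _ _ hgx), neg_mem (smul_mem _ _ hgy)⟩, hgx, hgy⟩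
  have := finrank_mono hrange
  have := finrank_span_singleton_le (k := k) (g y)
  omega

end LinearAlgebra

section Action

variable {k R D : Type*} [Field k] [CommRing R] [Algebra k R] [AddCommGroup D] [Module k D]
  [Module R D]

/-- The elements of `V` that annihilate the subspace `Q`. -/
def annihilatorIn (V : Submodule k R) (Q : Submodule k D) : Submodule k R :=
  V ⊓ (span R (Q : Set D)).annihilator.restrictScalars k

theorem mem_annihilatorIn {V : Submodule k R} {Q : Submodule k D} {v : R} :
    v ∈ annihilatorIn V Q ↔ v ∈ V ∧ ∀ q ∈ Q, v • q = 0 := by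
  simp [annihilatorIn, mem_annihilator_span]

theorem annihilatorIn_le (V : Submodule k R) (Q : Submodule k D) : annihilatorIn V Q ≤ V :=
  inf_le_left

variable [IsScalarTower k R D]

theorem mem_annihilatorIn_span {V : Submodule k R} {T : Set D} {v : R} :
    v ∈ annihilatorIn V (span k T) ↔ v ∈ V ∧ ∀ q ∈ T, v • q = 0 := by
  simp [annihilatorIn, span_span_of_tower, mem_annihilator_span]

variable (k) in
/-- The `k`-linear map `x ↦ x • F`. -/
def orbitMap (F : D) : R →ₗ[k] D :=
  (LinearMap.toSpanSingleton R D F).restrictScalars k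

@[simp]
theorem orbitMap_apply (F : D) (x : R) : orbitMap k F x = x • F := rfl

theorem smul_span_singleton (S : Submodule k R) (F : D) : S • (k ∙ F) = S.map (orbitMap k F) := by
  refine le_antisymm (smul_le.2 fun x hx y hy => ?_) (map_le_iff_le_comap.2 fun x hx =>
    smul_mem_smul hx (mem_span_singleton_self F))
  obtain ⟨a, rfl⟩ := mem_span_singleton.1 hy
  exact ⟨a • x, S.smul_mem a hx, by simp [smul_comm x a]⟩

theorem mem_smul_span_singleton {S : Submodule k R} {F y : D} :
    y ∈ S • (k ∙ F) ↔ ∃ x ∈ S, x • F = y := by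
  simp [smul_span_singleton]

theorem smul_span_singleton_le {S : Submodule k R} {F : D} {N : Submodule k D} :
    S • (k ∙ F) ≤ N ↔ ∀ x ∈ S, x • F ∈ N := by
  rw [smul_span_singleton, map_le_iff_le_comap]
  rfl

theorem smul_span_pair (S : Submodule k R) (F G : D) :
    S • span k {F, G} = S • (k ∙ F) ⊔ S • (k ∙ G) := by
  rw [span_insert, Submodule.smul_sup]

theorem smul_span_pair_le {S : Submodule k R} {F G : D} {N : Submodule k D} :
    S • span k {F, G} ≤ N ↔ ∀ x ∈ S, x • F ∈ N ∧ x • G ∈ N := by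
  rw [smul_span_pair, sup_le_iff, smul_span_singleton_le, smul_span_singleton_le, ← forall₂_and]

theorem smul_fst_mem {S : Submodule k R} {x : R} (hx : x ∈ S) (F G : D) :
    x • F ∈ S • span k {F, G} :=
  smul_mem_smul hx (mem_span_pair.2 ⟨1, 0, by simp⟩)

theorem smul_snd_mem {S : Submodule k R} {x : R} (hx : x ∈ S) (F G : D) :
    x • G ∈ S • span k {F, G} :=
  smul_mem_smul hx (mem_span_pair.2 ⟨0, 1, by simp⟩)

theorem smul_span_singleton_add_le (S : Submodule k R) (F G : D) (c : k) :
    S • (k ∙ (F + c • G)) ≤ S • span k {F, G} := by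
  rw [← span_pair_add_smul F G c]
  exact smul_mono_right _ (span_mono (by simp))

instance (S : Submodule k R) [FiniteDimensional k S] (W : Submodule k D) [FiniteDimensional k W] :
    FiniteDimensional k (S • W : Submodule k D) := by
  have h : S • W = map₂ (Algebra.lsmul k k D).toLinearMap S W :=
    le_antisymm (smul_le.2 fun x hx y hy => apply_mem_map₂ _ hx hy)
      (map₂_le.2 fun x hx y hy => smul_mem_smul hx hy)
  rw [h]
  exact Finite.iff_fg.2 (FG.map₂ _ (Finite.iff_fg.1 inferInstance) (Finite.iff_fg.1 inferInstance))

/-- The pairs `(z, w)` of elements of `S` with `z • F + w • G = 0`. -/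
def syzygies (S : Submodule k R) (F G : D) : Submodule k (R × R) :=
  S.prod S ⊓ LinearMap.ker ((orbitMap k F).coprod (orbitMap k G))

theorem mem_syzygies {S : Submodule k R} {F G : D} {p : R × R} :
    p ∈ syzygies S F G ↔ (p.1 ∈ S ∧ p.2 ∈ S) ∧ p.1 • F + p.2 • G = 0 := by
  simp [syzygies, mem_prod]

instance (S : Submodule k R) [FiniteDimensional k S] (F G : D) :
    FiniteDimensional k (syzygies S F G) :=
  finiteDimensional_of_le inf_le_left

theorem finrank_smul_span_pair_add_finrank_syzygies (S : Submodule k R) [FiniteDimensional k S]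
    (F G : D) :
    finrank k (S • span k {F, G} : Submodule k D) + finrank k (syzygies S F G) =
      2 * finrank k S := by
  rw [smul_span_pair, smul_span_singleton, smul_span_singleton, ← LinearMap.coprod_map_prod,
    syzygies, finrank_map_add_finrank_inf_ker, finrank_prod_submodule, two_mul]

/-- The pencil spanned by `F` and `G` contains enough information on `V`: `V` acts faithfully on it,
`V • ⟨F, G⟩` has the dimension of `V`, and pairing it with `V ^ m` by means of the functional `ε`
is nondegenerate. For the dual generators `F, G` of a level algebra of socle degree `m + 1`, with
`V` the space of linear forms and `ε` the evaluation at `1`, these hold as soon as `a = r`. -/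
structure Nondegenerate (V : Submodule k R) (F G : D) (m : ℕ) (ε : D →ₗ[k] k) : Prop where
  eq_zero : ∀ P ∈ V • span k {F, G}, (∀ y ∈ V ^ m, ε (y • P) = 0) → P = 0
  faithful : ∀ v ∈ V, v • F = 0 → v • G = 0 → v = 0
  finrank_eq : finrank k (V • span k {F, G} : Submodule k D) = finrank k V

theorem pow_smul_mem_span_singleton {V : Submodule k R} {P : D} {z : R}
    (h : ∀ v ∈ V, v • P ∈ k ∙ (z • P)) (n : ℕ) {y : R} (hy : y ∈ V ^ n) :
    y • P ∈ k ∙ (z ^ n • P) := by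
  induction hy using Submodule.pow_induction_on_left' with
  | algebraMap a => exact mem_span_singleton.2 ⟨a, by simp⟩
  | add x y _ _ _ hx hy => rw [add_smul]; exact add_mem hx hy
  | mem_mul v hv i y _ ih =>
    obtain ⟨a, ha⟩ := mem_span_singleton.1 ih
    obtain ⟨b, hb⟩ := mem_span_singleton.1 (h v hv)
    refine mem_span_singleton.2 ⟨a * b, ?_⟩
    rw [mul_smul v, ← ha, smul_comm v a, smul_comm v (z ^ i), ← hb, pow_succ, mul_smul, mul_smul,
      smul_comm (z ^ i) b]

theorem Nondegenerate.map_ne_zero {V : Submodule k R} {F G : D} {m : ℕ} {ε : D →ₗ[k] k}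
    (hN : Nondegenerate V F G m ε) {P : D} (hP : P ∈ V • span k {F, G}) (hP0 : P ≠ 0) {z : R}
    (hz : ∀ v ∈ V, v • P ∈ k ∙ (z • P)) : ε (z ^ m • P) ≠ 0 := fun h0 => by
  refine hP0 (hN.eq_zero P hP fun y hy => ?_)
  obtain ⟨a, ha⟩ := mem_span_singleton.1 (pow_smul_mem_span_singleton hz m hy)
  rw [← ha, map_smul, h0, smul_zero]

theorem Nondegenerate.finrank_syzygies {V : Submodule k R} [FiniteDimensional k V] {F G : D}
    {m : ℕ} {ε : D →ₗ[k] k} (hN : Nondegenerate V F G m ε) :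
    finrank k (syzygies V F G) = finrank k V := by
  have := finrank_smul_span_pair_add_finrank_syzygies V F G
  rw [hN.finrank_eq] at this
  omega

theorem smul_mem_span_singleton_of_le_sup {V : Submodule k R} {Q : Submodule k D} {z : R}
    (hz : V ≤ annihilatorIn V Q ⊔ k ∙ z) {P : D} (hP : P ∈ Q) :
    ∀ v ∈ V, v • P ∈ k ∙ (z • P) := fun v hv => by
  obtain ⟨w, hw, y, hy, rfl⟩ := mem_sup.1 (hz hv)
  obtain ⟨a, rfl⟩ := mem_span_singleton.1 hy
  exact mem_span_singleton.2
    ⟨a, by rw [add_smul, (mem_annihilatorIn.1 hw).2 P hP, zero_add, smul_assoc]⟩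

section Faithful

variable {V U : Submodule k R} {F G : D} {Q : Submodule k D}

theorem finrank_map_orbitMap_prod [FiniteDimensional k U]
    (hfaith : ∀ v ∈ U, v • F = 0 → v • G = 0 → v = 0) :
    finrank k (U.map ((orbitMap k F).prod (orbitMap k G))) = finrank k U := by
  have h := finrank_map_add_finrank_inf_ker ((orbitMap k F).prod (orbitMap k G)) U
  have hker : U ⊓ LinearMap.ker ((orbitMap k F).prod (orbitMap k G)) = ⊥ := by
    refine eq_bot_iff.2 fun u ⟨hu, h⟩ => hfaith u hu ?_ ?_
    exacts [congrArg Prod.fst h, congrArg Prod.snd h]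
  rwa [hker, finrank_bot, add_zero] at h

theorem map_orbitMap_prod_le (hQ : U • span k {F, G} ≤ Q) :
    U.map ((orbitMap k F).prod (orbitMap k G)) ≤ Q.prod Q :=
  map_le_iff_le_comap.2 fun u hu => smul_span_pair_le.1 hQ u hu

variable [FiniteDimensional k U] [FiniteDimensional k Q]

theorem finrank_le_two_mul (hfaith : ∀ v ∈ U, v • F = 0 → v • G = 0 → v = 0)
    (hQ : U • span k {F, G} ≤ Q) : finrank k U ≤ 2 * finrank k Q := by
  rw [← finrank_map_orbitMap_prod hfaith, two_mul, ← finrank_prod_submodule]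
  exact finrank_mono (map_orbitMap_prod_le hQ)

theorem mem_of_smul_mem (hfaith : ∀ v ∈ V, v • F = 0 → v • G = 0 → v = 0) (hUV : U ≤ V)
    (hQ : U • span k {F, G} ≤ Q) (hQU : 2 * finrank k Q ≤ finrank k U) {w : R} (hw : w ∈ V)
    (hF : w • F ∈ Q) (hG : w • G ∈ Q) : w ∈ U := by
  have hmap : U.map ((orbitMap k F).prod (orbitMap k G)) = Q.prod Q := by
    refine eq_of_le_of_finrank_le (map_orbitMap_prod_le hQ) ?_
    rwa [finrank_map_orbitMap_prod fun v hv => hfaith v (hUV hv), finrank_prod_submodule,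
      ← two_mul]
  obtain ⟨u, hu, huw⟩ : (w • F, w • G) ∈ U.map ((orbitMap k F).prod (orbitMap k G)) :=
    hmap ▸ ⟨hF, hG⟩
  obtain ⟨huF, huG⟩ := Prod.ext_iff.1 huw
  have : w - u = 0 := hfaith _ (sub_mem hw (hUV hu))
    (by simpa [sub_smul, sub_eq_zero] using huF.symm)
    (by simpa [sub_smul, sub_eq_zero] using huG.symm)
  rwa [sub_eq_zero.1 this]

end Faithful

end Action

/-! ### Singular pencils -/

section Kernels

variable {k R D : Type*} [Field k] [CommRing R] [Algebra k R] [AddCommGroup D] [Module k D]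
  [Module R D]

/-- A nonzero element `x c` of `V` killing `F + c • G` for every parameter `c`, together with the
space `U` spanned by the `x c` for almost all `c`: removing finitely many parameters besides those
in `s` does not make the span smaller. -/
structure KernelFamily (V : Submodule k R) (F G : D) (U : Submodule k R) (s : Finset k)
    (x : k → R) : Prop where
  mem : ∀ c, x c ∈ V
  ne_zero : ∀ c, x c ≠ 0
  smul_fst : ∀ c, x c • F = -(c • x c • G)
  span_eq : ∀ t : Finset k, s ⊆ t → span k (x '' {c | c ∉ t}) = U

namespace KernelFamily

variable {V : Submodule k R} {F G : D} {U : Submodule k R} {s : Finset k} {x : k → R}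

theorem le (hx : KernelFamily V F G U s x) : U ≤ V := by
  rw [← hx.span_eq s subset_rfl, span_le]
  rintro _ ⟨c, -, rfl⟩
  exact hx.mem c

theorem mem_of_notMem (hx : KernelFamily V F G U s x) {c : k} (hc : c ∉ s) : x c ∈ U :=
  hx.span_eq s subset_rfl ▸ subset_span ⟨c, hc, rfl⟩

theorem smul_ne_zero (hx : KernelFamily V F G U s x)
    (hfaith : ∀ v ∈ V, v • F = 0 → v • G = 0 → v = 0) (c : k) : x c • G ≠ 0 := fun h =>
  hx.ne_zero c (hfaith _ (hx.mem c) (by rw [hx.smul_fst, h, smul_zero, neg_zero]) h)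

theorem finiteDimensional [FiniteDimensional k V] (hx : KernelFamily V F G U s x) :
    FiniteDimensional k U :=
  finiteDimensional_of_le hx.le

variable [IsScalarTower k R D]

theorem smul_mem (hx : KernelFamily V F G U s x) {c : k} (hc : c ∉ s) :
    x c • G ∈ U • span k {F, G} :=
  smul_snd_mem (hx.mem_of_notMem hc) F G

theorem smul_add_smul (hx : KernelFamily V F G U s x) (c d : k) :
    x d • (F + c • G) = (c - d) • x d • G := by
  rw [smul_add, hx.smul_fst, smul_comm (x d) c, sub_smul]
  abel

theorem smul_smul_eq_zero (hx : KernelFamily V F G U s x) {c d : k} (hcd : c ≠ d) :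
    x c • x d • G = 0 := by
  have h : (c - d) • x c • x d • G = 0 := by
    rw [← smul_comm (x c), ← hx.smul_add_smul, smul_comm, hx.smul_add_smul, sub_self, zero_smul,
      smul_zero]
  exact (smul_eq_zero.1 h).resolve_left (sub_ne_zero.2 hcd)

theorem smul_span_pair_eq (hx : KernelFamily V F G U s x) {t : Finset k} (ht : s ⊆ t) :
    U • span k {F, G} = span k ((fun c => x c • G) '' {c | c ∉ t}) := by
  set N := span k ((fun c => x c • G) '' {c | c ∉ t})
  apply le_antisymm
  · have hU : U ≤ N.comap (orbitMap k F) ⊓ N.comap (orbitMap k G) := by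
      rw [← hx.span_eq t ht, span_le]
      rintro _ ⟨c, hc, rfl⟩
      have hcN : x c • G ∈ N := subset_span ⟨c, hc, rfl⟩
      exact ⟨by simpa [hx.smul_fst] using N.smul_mem c hcN, hcN⟩
    exact smul_span_pair_le.2 fun u hu => hU hu
  · rw [span_le]
    rintro _ ⟨c, hc, rfl⟩
    exact hx.smul_mem fun h => hc (ht h)

theorem mem_annihilatorIn (hx : KernelFamily V F G U s x) {t : Finset k} (ht : s ⊆ t) {v : R}
    (hv : v ∈ V) (h : ∀ c ∉ t, v • x c • G = 0) : v ∈ annihilatorIn V (U • span k {F, G}) := by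
  rw [hx.smul_span_pair_eq ht, mem_annihilatorIn_span]
  exact ⟨hv, by rintro _ ⟨c, hc, rfl⟩; exact h c hc⟩

theorem le_annihilatorIn (hx : KernelFamily V F G U s x) :
    U ≤ annihilatorIn V (U • span k {F, G}) := by
  classical
  rw [← hx.span_eq s subset_rfl, span_le, hx.span_eq s subset_rfl]
  rintro _ ⟨c, -, rfl⟩
  refine hx.mem_annihilatorIn (Finset.subset_insert c s) (hx.mem c) fun d hd =>
    hx.smul_smul_eq_zero ?_
  rintro rfl
  exact hd (Finset.mem_insert_self _ _)

theorem smul_snd_of_relation (hx : KernelFamily V F G U s x) {z w : R}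
    (h : z • F + w • G = 0) (c : k) : w • x c • G = c • z • x c • G := by
  have := congrArg (x c • ·) h
  simp only [smul_add, smul_zero, smul_comm (x c) z, hx.smul_fst, smul_neg, smul_comm z c,
    smul_comm (x c) w] at this
  rwa [neg_add_eq_zero, eq_comm] at this

theorem disjoint_ker_domRestrict (hx : KernelFamily V F G U s x)
    (hfaith : ∀ v ∈ V, v • F = 0 → v • G = 0 → v = 0) :
    Disjoint (LinearMap.ker ((orbitMap k F).domRestrict U))
      (LinearMap.ker ((orbitMap k G).domRestrict U)) :=
  disjoint_def.2 fun u hF hG => Subtype.ext (hfaith u (hx.le u.2) hF hG)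

theorem mem_ker_pencil (hx : KernelFamily V F G U s x) {c : k} (hc : c ∉ s) :
    (⟨x c, hx.mem_of_notMem hc⟩ : U) ∈
      LinearMap.ker ((orbitMap k F).domRestrict U + c • (orbitMap k G).domRestrict U) := by
  simp [hx.smul_fst]

variable [FiniteDimensional k V] [Infinite k]

theorem two_le_finrank (hx : KernelFamily V F G U s x)
    (hfaith : ∀ v ∈ V, v • F = 0 → v • G = 0 → v = 0) : 2 ≤ finrank k U := by
  classical
  have := hx.finiteDimensional
  obtain ⟨c, hc⟩ := Infinite.exists_notMem_finset s
  obtain ⟨d, hd⟩ := Infinite.exists_notMem_finset (insert c s)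
  rw [Finset.mem_insert, not_or] at hd
  simpa using (linearIndependent_of_mem_ker_pencil (hx.disjoint_ker_domRestrict hfaith)
    (Ne.symm hd.1) (fun h => hx.ne_zero c (congrArg Subtype.val h))
    (fun h => hx.ne_zero d (congrArg Subtype.val h)) (hx.mem_ker_pencil hc)
    (hx.mem_ker_pencil hd.2)).fintype_card_le_finrank

theorem finrank_smul_lt (hx : KernelFamily V F G U s x)
    (hfaith : ∀ v ∈ V, v • F = 0 → v • G = 0 → v = 0) (hU : finrank k U ≤ 2) :
    finrank k (U • span k {F, G} : Submodule k D) < finrank k U := by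
  have := hx.finiteDimensional
  by_contra! hle
  rw [smul_span_pair, smul_span_singleton, smul_span_singleton, ← LinearMap.range_domRestrict,
    ← LinearMap.range_domRestrict] at hle
  obtain ⟨c, hc, hker⟩ := exists_ker_pencil_eq_bot (hx.disjoint_ker_domRestrict hfaith) hU hle s
  have hxc := hx.mem_ker_pencil hc
  rw [hker, mem_bot] at hxc
  exact hx.ne_zero c (congrArg Subtype.val hxc)

end KernelFamily

variable [IsScalarTower k R D]

theorem exists_kernelFamily {V : Submodule k R} [FiniteDimensional k V] {F G : D}
    (h : ∀ c : k, ∃ x ∈ V, x • (F + c • G) = 0 ∧ x ≠ 0) :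
    ∃ (U : Submodule k R) (s : Finset k) (x : k → R), KernelFamily V F G U s x := by
  choose x hxV hx hx0 using h
  obtain ⟨s, hs⟩ := exists_finset_span_image_compl_eq hxV
  refine ⟨_, s, x, hxV, hx0, fun c => ?_, hs⟩
  rw [← add_eq_zero_iff_eq_neg, ← hx c, smul_add, smul_comm (x c) c]

/-- For eigenvectors of `w` relative to `z` with distinct eigenvalues `c i`, the product of the
`w - c j • z` over `j ≠ i` singles out the `i`-th term of a linear relation. -/
theorem exists_pow_smul_eq_zero_of_not_linearIndependent {ι : Type*} [Fintype ι] {c : ι → k}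
    (hc : Function.Injective c) {z w : R} {y : ι → D} (hw : ∀ i, w • y i = c i • z • y i)
    (hy : ¬ LinearIndependent k y) : ∃ i, z ^ (Fintype.card ι - 1) • y i = 0 := by
  classical
  obtain ⟨g, hg, i, hi⟩ := Fintype.not_linearIndependent_iff.1 hy
  have hprod (q : Finset ι) (j : ι) :
      (∏ l ∈ q, (w - c l • z)) • y j = (∏ l ∈ q, (c j - c l)) • z ^ q.card • y j := by
    induction q using Finset.induction_on with
    | empty => simp
    | insert l q hl ih =>
      have hlj : (w - c l • z) • y j = (c j - c l) • z • y j := by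
        rw [sub_smul, hw, smul_assoc, sub_smul]
      rw [Finset.prod_insert hl, Finset.prod_insert hl, Finset.card_insert_of_notMem hl, mul_comm,
        mul_smul, hlj, smul_comm (∏ l ∈ q, (w - c l • z)), smul_comm (∏ l ∈ q, (w - c l • z)) z,
        ih, smul_comm z, mul_smul, pow_succ', mul_smul]
  refine ⟨i, ?_⟩
  have hsum := congrArg ((∏ l ∈ Finset.univ.erase i, (w - c l • z)) • ·) hg
  simp only [smul_zero, Finset.smul_sum] at hsum
  rw [Finset.sum_eq_single i (fun j _ hj => ?_) (by simp), smul_comm, hprod,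
    Finset.card_erase_of_mem (Finset.mem_univ i), Finset.card_univ] at hsum
  · refine (smul_eq_zero.1 ((smul_eq_zero.1 hsum).resolve_left hi)).resolve_left
      (Finset.prod_ne_zero_iff.2 fun l hl => sub_ne_zero.2 fun h => ?_)
    exact Finset.ne_of_mem_erase hl (hc h.symm)
  · rw [smul_comm, hprod, Finset.prod_eq_zero (i := j) (by simp [hj]) (sub_self _), zero_smul,
      smul_zero]

end Kernels

section Dichotomy

variable {k R D : Type*} [Field k] [CommRing R] [Algebra k R] [AddCommGroup D] [Module k D]
  [Module R D] [IsScalarTower k R D]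

theorem exists_smul_span_pair_le_sup [Infinite k] {W : Submodule k R} [FiniteDimensional k W]
    {Q : Submodule k D} [FiniteDimensional k Q] {F G : D} (hW : finrank k W ≤ 2)
    (hfaith : ∀ w ∈ W, w • F ∈ Q → w • G ∈ Q → w = 0)
    (hdim : finrank k W + finrank k Q = finrank k (W • span k {F, G} ⊔ Q : Submodule k D))
    (s : Finset k) : ∃ c ∉ s, W • span k {F, G} ≤ W • (k ∙ (F + c • G)) ⊔ Q := by
  let f (H : D) : W →ₗ[k] D ⧸ Q := (Q.mkQ ∘ₗ orbitMap k H).domRestrict W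
  have hf (H : D) : LinearMap.range (f H) = (W • (k ∙ H)).map Q.mkQ := by
    rw [smul_span_singleton, ← Submodule.map_comp, LinearMap.range_domRestrict]
  have hdisj : Disjoint (LinearMap.ker (f F)) (LinearMap.ker (f G)) :=
    disjoint_def.2 fun w hF hG => Subtype.ext <| hfaith w w.2
      ((Quotient.mk_eq_zero Q).1 hF) ((Quotient.mk_eq_zero Q).1 hG)
  have hrange := finrank_map_mkQ_add_finrank (W • span k {F, G}) Q
  rw [smul_span_pair, Submodule.map_sup, ← hf, ← hf, ← smul_span_pair] at hrange
  obtain ⟨c, hc, hker⟩ := exists_ker_pencil_eq_bot hdisj hW (by omega) s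
  have hfc : f F + c • f G = f (F + c • G) := by
    ext w
    simp [f, smul_comm (w : R) c]
  refine ⟨c, hc, le_sup_left.trans (eq_of_le_of_finrank_le
    (sup_le_sup_right (smul_span_singleton_add_le W F G c) Q) ?_).ge⟩
  rw [← hdim, ← finrank_map_mkQ_add_finrank, ← hf, ← hfc,
    LinearMap.finrank_range_of_inj (LinearMap.ker_eq_bot.1 hker)]

namespace KernelFamily

variable {V : Submodule k R} {F G : D} {U : Submodule k R} {s : Finset k}
  {x : k → R} {m : ℕ} {ε : D →ₗ[k] k}

theorem finrank_smul_le_one_of_le_sup (hx : KernelFamily V F G U s x)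
    (hN : Nondegenerate V F G m ε) {z : R}
    (hz : V ≤ annihilatorIn V (U • span k {F, G}) ⊔ k ∙ z) :
    finrank k (U • span k {F, G} : Submodule k D) ≤ 1 := by
  let f : (U • span k {F, G} : Submodule k D) →ₗ[k] k :=
    ε ∘ₗ Algebra.lsmul k k D (z ^ m) ∘ₗ (U • span k {F, G}).subtype
  have hf : Function.Injective f := by
    refine (injective_iff_map_eq_zero f).2 fun P hP => ?_
    by_contra hP0
    exact hN.map_ne_zero (smul_mono_left hx.le P.2) (fun h => hP0 (Subtype.ext h))
      (smul_mem_span_singleton_of_le_sup hz P.2) hP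
  simpa using LinearMap.finrank_le_finrank_of_injective hf

theorem snd_mem_annihilatorIn (hx : KernelFamily V F G U s x) {p : R × R}
    (hp : p ∈ syzygies V F G) (h : p.1 ∈ annihilatorIn V (U • span k {F, G})) :
    p.2 ∈ annihilatorIn V (U • span k {F, G}) := by
  obtain ⟨⟨-, hw⟩, hzw⟩ := mem_syzygies.1 hp
  refine hx.mem_annihilatorIn subset_rfl hw fun c hc => ?_
  rw [hx.smul_snd_of_relation hzw, (LevelAlg.mem_annihilatorIn.1 h).2 _ (hx.smul_mem hc),
    smul_zero]

theorem fst_mem_annihilatorIn (hx : KernelFamily V F G U s x) {p : R × R}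
    (hp : p ∈ syzygies V F G) (h : p.2 ∈ annihilatorIn V (U • span k {F, G}) ⊔ k ∙ p.1) :
    p.1 ∈ annihilatorIn V (U • span k {F, G}) := by
  classical
  obtain ⟨⟨hz, -⟩, hzw⟩ := mem_syzygies.1 hp
  obtain ⟨y, hy, y', hy', hyw⟩ := mem_sup.1 h
  obtain ⟨a, rfl⟩ := mem_span_singleton.1 hy'
  refine hx.mem_annihilatorIn (Finset.subset_insert a s) hz fun c hc => ?_
  rw [Finset.mem_insert, not_or] at hc
  have hac : a • p.1 • x c • G = c • p.1 • x c • G := by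
    rw [← hx.smul_snd_of_relation hzw, ← hyw, add_smul,
      (LevelAlg.mem_annihilatorIn.1 hy).2 _ (hx.smul_mem hc.2), zero_add, smul_assoc]
  rw [← sub_eq_zero, ← sub_smul] at hac
  exact (smul_eq_zero.1 hac).resolve_left (sub_ne_zero.2 (Ne.symm hc.1))

theorem annihilatorIn_lt [Infinite k] (hx : KernelFamily V F G U s x) (hN : Nondegenerate V F G m ε)
    (hm : m ≠ 0) : annihilatorIn V (U • span k {F, G}) < V := by
  refine (annihilatorIn_le _ _).lt_of_ne fun h => ?_
  obtain ⟨c, hc⟩ := Infinite.exists_notMem_finset s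
  refine hN.map_ne_zero (smul_mono_left hx.le (hx.smul_mem hc)) (hx.smul_ne_zero hN.faithful c)
    (smul_mem_span_singleton_of_le_sup (z := 0) (by simp [h]) (hx.smul_mem hc)) ?_
  rw [zero_pow hm, zero_smul, map_zero]

variable [FiniteDimensional k V]

theorem finrank_annihilatorIn_lt (hx : KernelFamily V F G U s x) (hN : Nondegenerate V F G m ε)
    (hQ : 1 < finrank k (U • span k {F, G} : Submodule k D)) :
    finrank k (annihilatorIn V (U • span k {F, G})) + 1 < finrank k V := by
  by_contra! hA
  rcases (annihilatorIn_le V (U • span k {F, G})).eq_or_lt with h | h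
  · exact hQ.not_ge (hx.finrank_smul_le_one_of_le_sup (z := 0) hN (by simp [h]))
  · obtain ⟨z, hz⟩ := exists_sup_span_singleton_eq h hA
    exact hQ.not_ge (hx.finrank_smul_le_one_of_le_sup hN hz.ge)

theorem exists_pow_finrank_smul_eq_zero [Infinite k] (hx : KernelFamily V F G U s x) {z w : R}
    (hzw : z • F + w • G = 0) : ∃ c ∉ s, z ^ finrank k U • x c • G = 0 := by
  have := hx.finiteDimensional
  have : Infinite {c | c ∉ s} := s.finite_toSet.infinite_compl.to_subtype
  let c : Fin (finrank k U + 1) ↪ {c | c ∉ s} := Fin.valEmbedding.trans (Infinite.natEmbedding _)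
  have hdep : ¬ LinearIndependent k fun i => x (c i) • G := fun h => by
    have hle : span k (Set.range fun i => x (c i) • G) ≤ U.map (orbitMap k G) := by
      rw [span_le]
      rintro _ ⟨i, rfl⟩
      exact ⟨x (c i), hx.mem_of_notMem (c i).2, rfl⟩
    have := (finrank_mono hle).trans (finrank_map_le _ U)
    rw [finrank_span_eq_card h, Fintype.card_fin] at this
    omega
  obtain ⟨i, hi⟩ := exists_pow_smul_eq_zero_of_not_linearIndependent
    (c := fun i => (c i : k)) (Subtype.val_injective.comp c.injective)
    (fun i => hx.smul_snd_of_relation hzw (c i)) hdep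
  exact ⟨c i, (c i).2, by simpa using hi⟩

theorem not_le_sup_span_pair [Infinite k] (hx : KernelFamily V F G U s x)
    (hN : Nondegenerate V F G m ε) (hU : finrank k U ≤ m) {z w : R} (hzw : z • F + w • G = 0) :
    ¬ V ≤ annihilatorIn V (U • span k {F, G}) ⊔ span k {z, w} := fun hV => by
  obtain ⟨c, hc, hzc⟩ := hx.exists_pow_finrank_smul_eq_zero hzw
  refine hN.map_ne_zero (smul_mono_left hx.le (hx.smul_mem hc)) (hx.smul_ne_zero hN.faithful c)
    (z := z) (fun v hv => ?_) ?_
  · obtain ⟨y, hy, y', hy', rfl⟩ := mem_sup.1 (hV hv)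
    obtain ⟨a, b, rfl⟩ := mem_span_pair.1 hy'
    refine mem_span_singleton.2 ⟨a + b * c, ?_⟩
    rw [add_smul y, (LevelAlg.mem_annihilatorIn.1 hy).2 _ (hx.smul_mem hc), zero_add,
      add_smul (a • z), smul_assoc, smul_assoc, hx.smul_snd_of_relation hzw, add_smul, mul_smul]
  · rw [← Nat.sub_add_cancel hU, pow_add, mul_smul, hzc, smul_zero, map_zero]

theorem exists_le_sup_span_pair (hx : KernelFamily V F G U s x)
    (hA : finrank k V ≤ finrank k (annihilatorIn V (U • span k {F, G})) + 2)
    (hsyz : ¬ syzygies V F G ≤ syzygies (annihilatorIn V (U • span k {F, G})) F G) :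
    ∃ z w : R, z • F + w • G = 0 ∧
      V ≤ annihilatorIn V (U • span k {F, G}) ⊔ span k {z, w} := by
  set A := annihilatorIn V (U • span k {F, G})
  obtain ⟨p, hp, hpA⟩ := SetLike.not_le_iff_exists.1 hsyz
  obtain ⟨⟨hzV, hwV⟩, hzw⟩ := mem_syzygies.1 hp
  have hz : p.1 ∉ A := fun h =>
    hpA (mem_syzygies.2 ⟨⟨h, hx.snd_mem_annihilatorIn hp h⟩, hzw⟩)
  have hw : p.2 ∉ A ⊔ k ∙ p.1 := fun h => hz (hx.fst_mem_annihilatorIn hp h)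
  have hAV : A ⊔ k ∙ p.1 ⊔ k ∙ p.2 ≤ V :=
    sup_le (sup_le (annihilatorIn_le _ _) (by simpa using hzV)) (by simpa using hwV)
  have := finiteDimensional_of_le (annihilatorIn_le V (U • span k {F, G}))
  have hz' := finrank_lt_finrank_sup_span hz
  have hw' := finrank_lt_finrank_sup_span hw
  refine ⟨p.1, p.2, hzw, ?_⟩
  rw [span_insert, ← sup_assoc]
  exact (eq_of_le_of_finrank_le hAV (by omega)).ge

theorem smul_span_pair_eq_span_singleton (hx : KernelFamily V F G U s x)
    (hN : Nondegenerate V F G m ε)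
    (hQ : finrank k (U • span k {F, G} : Submodule k D) = 1) {c : k} (hc : c ∉ s) :
    U • span k {F, G} = k ∙ (x c • G) := by
  have := hx.finiteDimensional
  exact eq_span_singleton_of_finrank_le_one hQ.le (hx.smul_mem hc) (hx.smul_ne_zero hN.faithful c)

variable [Infinite k]

theorem finrank_smul_le_one (hx : KernelFamily V F G U s x) (hN : Nondegenerate V F G m ε)
    (hm : 3 ≤ m) (hV : finrank k V ≤ 5) :
    finrank k (U • span k {F, G} : Submodule k D) ≤ 1 := by
  by_contra! hQ
  have := finiteDimensional_of_le (annihilatorIn_le V (U • span k {F, G}))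
  have := hx.finiteDimensional
  have hA := hx.finrank_annihilatorIn_lt hN hQ
  have hU2 := hx.finrank_smul_lt hN.faithful
  have hUA := finrank_mono hx.le_annihilatorIn
  have hU3 : finrank k U = 3 := by omega
  have hA3 : U = annihilatorIn V (U • span k {F, G}) :=
    eq_of_le_of_finrank_le hx.le_annihilatorIn (by omega)
  obtain ⟨z, w, hzw, hle⟩ := hx.exists_le_sup_span_pair (by omega) fun hsyz => by
    have hsyz' := finrank_mono hsyz
    rw [hN.finrank_syzygies, ← hA3] at hsyz'
    have := finrank_smul_span_pair_add_finrank_syzygies U F G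
    omega
  exact hx.not_le_sup_span_pair hN (by omega) hzw hle

theorem finrank_smul_eq_one (hx : KernelFamily V F G U s x) (hN : Nondegenerate V F G m ε)
    (hm : 3 ≤ m) (hV : finrank k V ≤ 5) :
    finrank k (U • span k {F, G} : Submodule k D) = 1 := by
  have := hx.finiteDimensional
  obtain ⟨c, hc⟩ := Infinite.exists_notMem_finset s
  refine (hx.finrank_smul_le_one hN hm hV).antisymm (one_le_finrank_iff.2 fun h => ?_)
  exact hx.smul_ne_zero hN.faithful c ((mem_bot k).1 (h ▸ hx.smul_mem hc))

theorem finrank_eq_two (hx : KernelFamily V F G U s x) (hN : Nondegenerate V F G m ε)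
    (hQ : finrank k (U • span k {F, G} : Submodule k D) = 1) : finrank k U = 2 := by
  have := hx.finiteDimensional
  refine le_antisymm ?_ (hx.two_le_finrank hN.faithful)
  have := finrank_le_two_mul (fun u hu => hN.faithful u (hx.le hu)) (Q := U • span k {F, G}) le_rfl
  omega

theorem syzygies_le (hx : KernelFamily V F G U s x) (hN : Nondegenerate V F G m ε)
    (hQ : finrank k (U • span k {F, G} : Submodule k D) = 1) :
    syzygies V F G ≤ syzygies (annihilatorIn V (U • span k {F, G})) F G := by
  classical
  intro p hp
  obtain ⟨⟨hz, -⟩, hzw⟩ := mem_syzygies.1 hp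
  obtain ⟨c, hc⟩ := Infinite.exists_notMem_finset s
  obtain ⟨d, hd⟩ := Infinite.exists_notMem_finset (insert c s)
  rw [Finset.mem_insert, not_or] at hd
  have hQd := hx.smul_span_pair_eq_span_singleton hN hQ hd.2
  obtain ⟨a, ha⟩ := mem_span_singleton.1 (hQd ▸ hx.smul_mem hc)
  have ha0 : a ≠ 0 := by
    rintro rfl
    exact hx.smul_ne_zero hN.faithful c (by rw [← ha, zero_smul])
  have hzd : p.1 • x d • G = 0 := by
    have h := hx.smul_snd_of_relation hzw c
    rw [← ha, smul_comm p.2, hx.smul_snd_of_relation hzw d, smul_comm p.1 a, smul_comm c a] at h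
    have h' := smul_right_injective D ha0 h
    rw [← sub_eq_zero, ← sub_smul] at h'
    exact (smul_eq_zero.1 h').resolve_left (sub_ne_zero.2 hd.1)
  have hzA : p.1 ∈ annihilatorIn V (U • span k {F, G}) := by
    rw [hQd, mem_annihilatorIn_span]
    exact ⟨hz, by simpa using hzd⟩
  exact mem_syzygies.2 ⟨⟨hzA, hx.snd_mem_annihilatorIn hp hzA⟩, hzw⟩

theorem finrank_annihilatorIn_smul_add (hx : KernelFamily V F G U s x)
    (hN : Nondegenerate V F G m ε)
    (hQ : finrank k (U • span k {F, G} : Submodule k D) = 1) :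
    finrank k (annihilatorIn V (U • span k {F, G}) • span k {F, G} : Submodule k D) +
      finrank k V = 2 * finrank k (annihilatorIn V (U • span k {F, G})) := by
  have := finiteDimensional_of_le (annihilatorIn_le V (U • span k {F, G}))
  have hsyz : syzygies (annihilatorIn V (U • span k {F, G})) F G = syzygies V F G :=
    (inf_le_inf_right _ (prod_mono (annihilatorIn_le _ _) (annihilatorIn_le _ _))).antisymm
      (hx.syzygies_le hN hQ)
  rw [← finrank_smul_span_pair_add_finrank_syzygies _ F G, hsyz, hN.finrank_syzygies]

theorem finrank_annihilatorIn_add_one (hx : KernelFamily V F G U s x)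
    (hN : Nondegenerate V F G m ε) (hm : m ≠ 0) (hV : finrank k V ≤ 5)
    (hQ : finrank k (U • span k {F, G} : Submodule k D) = 1) :
    finrank k (annihilatorIn V (U • span k {F, G})) + 1 = finrank k V := by
  have := finiteDimensional_of_le (annihilatorIn_le V (U • span k {F, G}))
  have := hx.finiteDimensional
  have hU := hx.finrank_eq_two hN hQ
  have hAV := finrank_lt_finrank_of_lt (hx.annihilatorIn_lt hN hm)
  have hA := hx.finrank_annihilatorIn_smul_add hN hQ
  by_contra hne
  have hQA : U • span k {F, G} = annihilatorIn V (U • span k {F, G}) • span k {F, G} :=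
    eq_of_le_of_finrank_le (smul_mono_left hx.le_annihilatorIn) (by omega)
  have hAU : annihilatorIn V (U • span k {F, G}) ≤ U := fun w hw =>
    mem_of_smul_mem hN.faithful hx.le le_rfl (by omega) (annihilatorIn_le _ _ hw)
      (hQA ▸ smul_fst_mem hw F G) (hQA ▸ smul_snd_mem hw F G)
  have := finrank_mono hAU
  rw [hQA] at hQ
  omega

theorem exists_smul_span_pair_le (hx : KernelFamily V F G U s x) (hN : Nondegenerate V F G m ε)
    (hQ : finrank k (U • span k {F, G} : Submodule k D) = 1) {A : Submodule k R} (hUA : U ≤ A)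
    (hAV : A ≤ V) (hA4 : finrank k A ≤ 4)
    (hA : finrank k A = finrank k (A • span k {F, G} : Submodule k D) + 1) :
    ∃ c ∉ s, A • span k {F, G} ≤ A • (k ∙ (F + c • G)) ⊔ U • span k {F, G} := by
  have := hx.finiteDimensional
  have := finiteDimensional_of_le hAV
  have hU := hx.finrank_eq_two hN hQ
  obtain ⟨W, hUW, hUWA⟩ := IsModularLattice.exists_disjoint_and_sup_eq hUA
  have hWA : W ≤ A := hUWA ▸ le_sup_right
  have := finiteDimensional_of_le hWA
  have hdim := finrank_sup_add_finrank_inf_eq U W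
  rw [hUW.eq_bot, finrank_bot, hUWA, hU, add_zero] at hdim
  have hsup : W • span k {F, G} ⊔ U • span k {F, G} = A • span k {F, G} := by
    rw [← Submodule.sup_smul, sup_comm, hUWA]
  obtain ⟨c, hc, hle⟩ := exists_smul_span_pair_le_sup (W := W) (Q := U • span k {F, G}) (by omega)
    (fun w hw hF hG => disjoint_def.1 hUW w
      (mem_of_smul_mem hN.faithful hx.le le_rfl (by omega) (hAV (hWA hw)) hF hG) hw)
    (by rw [hsup]; omega) s
  exact ⟨c, hc, hsup.ge.trans (sup_le
    (hle.trans (sup_le_sup_right (smul_mono_left hWA) _)) le_sup_right)⟩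

theorem smul_span_pair_le_smul_span_singleton (hx : KernelFamily V F G U s x)
    (hN : Nondegenerate V F G m ε)
    (hQ : finrank k (U • span k {F, G} : Submodule k D) = 1) (c : k) :
    U • span k {F, G} ≤ V • (k ∙ (F + c • G)) := by
  classical
  obtain ⟨d, hd⟩ := Infinite.exists_notMem_finset (insert c s)
  rw [Finset.mem_insert, not_or] at hd
  rw [hx.smul_span_pair_eq_span_singleton hN hQ hd.2, span_singleton_le_iff_mem,
    ← smul_mem_iff _ (sub_ne_zero.2 (Ne.symm hd.1)), ← hx.smul_add_smul]
  exact smul_mem_smul (hx.mem d) (mem_span_singleton_self _)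

theorem exists_extension (hx : KernelFamily V F G U s x) (hN : Nondegenerate V F G m ε)
    (hm : 3 ≤ m) (hV : finrank k V ≤ 5) :
    ∃ (c : k) (A : Submodule k R) (x z : R), x ∈ V ∧ x ≠ 0 ∧ A ⊔ k ∙ z = V ∧
      x • (F + c • G) = 0 ∧ A • (k ∙ G) ≤ V • (k ∙ (F + c • G)) ∧ ∀ j ≤ m, x • z ^ j • G ≠ 0 := by
  have hQ := hx.finrank_smul_eq_one hN hm hV
  have hAV := hx.annihilatorIn_lt hN (by omega)
  have hA1 := hx.finrank_annihilatorIn_add_one hN (by omega) hV hQ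
  have hA2 := hx.finrank_annihilatorIn_smul_add hN hQ
  obtain ⟨z, hz⟩ := exists_sup_span_singleton_eq hAV hA1.ge
  obtain ⟨c, hc, hle⟩ := hx.exists_smul_span_pair_le hN hQ hx.le_annihilatorIn hAV.le (by omega)
    (by omega)
  refine ⟨c, _, x c, z, hx.mem c, hx.ne_zero c, hz, ?_, ?_, fun j hj h0 => ?_⟩
  · rw [hx.smul_add_smul, sub_self, zero_smul]
  · set A := annihilatorIn V (U • span k {F, G})
    calc A • (k ∙ G) ≤ A • span k {F, G} := smul_mono_right _ (span_mono (by simp))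
      _ ≤ A • (k ∙ (F + c • G)) ⊔ U • span k {F, G} := hle
      _ ≤ V • (k ∙ (F + c • G)) :=
        sup_le (smul_mono_left hAV.le) (hx.smul_span_pair_le_smul_span_singleton hN hQ c)
  · refine hN.map_ne_zero (smul_mono_left hx.le (hx.smul_mem hc)) (hx.smul_ne_zero hN.faithful c)
      (smul_mem_span_singleton_of_le_sup hz.ge (hx.smul_mem hc)) ?_
    rw [← Nat.sub_add_cancel hj, pow_add, mul_smul, smul_comm (z ^ j) (x c), h0, smul_zero,
      map_zero]

end KernelFamily

variable {V : Submodule k R} [FiniteDimensional k V] {F G : D} {m : ℕ} {ε : D →ₗ[k] k}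

theorem Nondegenerate.smul_span_singleton_le_of_faithful (hN : Nondegenerate V F G m ε) {c : k}
    (hc : ∀ v ∈ V, v • (F + c • G) = 0 → v = 0) : V • (k ∙ G) ≤ V • (k ∙ (F + c • G)) := by
  have hfin : finrank k (V • (k ∙ (F + c • G)) : Submodule k D) = finrank k V := by
    have hker : V ⊓ LinearMap.ker (orbitMap k (F + c • G)) = ⊥ :=
      eq_bot_iff.2 fun v hv => hc v hv.1 hv.2
    have h := finrank_map_add_finrank_inf_ker (orbitMap k (F + c • G)) V
    rwa [← smul_span_singleton, hker, finrank_bot, add_zero] at h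
  rw [eq_of_le_of_finrank_le (smul_span_singleton_add_le V F G c) (by rw [hfin, hN.finrank_eq])]
  exact smul_mono_right _ (span_mono (by simp))

theorem Nondegenerate.dichotomy [Infinite k] (hN : Nondegenerate V F G m ε) (hm : 3 ≤ m)
    (hV : finrank k V ≤ 5) :
    ∃ c : k, ((∀ v ∈ V, v • (F + c • G) = 0 → v = 0) ∧ V • (k ∙ G) ≤ V • (k ∙ (F + c • G))) ∨
      ∃ (A : Submodule k R) (x z : R), x ∈ V ∧ x ≠ 0 ∧ A ⊔ k ∙ z = V ∧
        x • (F + c • G) = 0 ∧ A • (k ∙ G) ≤ V • (k ∙ (F + c • G)) ∧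
          ∀ j ≤ m, x • z ^ j • G ≠ 0 := by
  by_cases! hcase : ∃ c : k, ∀ v ∈ V, v • (F + c • G) = 0 → v = 0
  · obtain ⟨c, hc⟩ := hcase
    exact ⟨c, Or.inl ⟨hc, hN.smul_span_singleton_le_of_faithful hc⟩⟩
  · obtain ⟨U, s, x, hx⟩ := exists_kernelFamily hcase
    obtain ⟨c, h⟩ := hx.exists_extension hN hm hV
    exact ⟨c, Or.inr h⟩

end Dichotomy

theorem finrank_homogeneousSubmodule (k : Type*) [Field k] (n d : ℕ) :
    finrank k (homogeneousSubmodule (Fin n) k d) = n.multichoose d := by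
  rw [homogeneousSubmodule_eq_finsupp_supported,
    (AddMonoidAlgebra.supportedEquivFinsupp _).finrank_eq]
  have hs : {f : Fin n →₀ ℕ | f.degree = d} =
      ((Finset.univ.finsuppAntidiag d : Finset (Fin n →₀ ℕ)) : Set (Fin n →₀ ℕ)) := by
    ext f
    simp [Finset.mem_finsuppAntidiag, Finsupp.degree_eq_sum]
  rw [hs, finrank_finsupp_self, ← Nat.card_eq_fintype_card, Nat.card_coe_set_eq,
    Set.ncard_coe_finset, Finset.card_finsuppAntidiag_nat_eq_multichoose, Finset.card_univ,
    Fintype.card_fin]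

theorem multichoose_le_multichoose {m n : ℕ} (h : m ≤ n) (i : ℕ) :
    m.multichoose i ≤ n.multichoose i := by
  rw [Nat.multichoose_eq, Nat.multichoose_eq]
  exact Nat.choose_le_choose _ (by omega)

/-! ### Powers of the space of linear forms -/

section Powers

variable {k R D : Type*} [Field k] [CommRing R] [Algebra k R] [AddCommGroup D] [Module k D]
  [Module R D] [IsScalarTower k R D]

instance (V : Submodule k R) [FiniteDimensional k V] (i : ℕ) : FiniteDimensional k ↥(V ^ i) :=
  Finite.iff_fg.2 ((Finite.iff_fg.1 ‹_›).pow i)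

theorem finrank_pow_le (T : Submodule k R) [FiniteDimensional k T] (i : ℕ) :
    finrank k ↥(T ^ i) ≤ (finrank k T).multichoose i := by
  let b := finBasis k T
  let f : MvPolynomial (Fin (finrank k T)) k →ₐ[k] R := aeval fun j => (b j : R)
  have hT : T = (homogeneousSubmodule (Fin (finrank k T)) k 1).map f.toLinearMap := by
    have hfb : f.toLinearMap ∘ X = T.subtype ∘ b := by
      funext j
      simp [f]
    rw [homogeneousSubmodule_one_eq_span_X, Submodule.map_span, ← Set.range_comp, hfb,
      Set.range_comp, ← Submodule.map_span, b.span_eq, Submodule.map_top, range_subtype]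
  have : FiniteDimensional k (homogeneousSubmodule (Fin (finrank k T)) k 1) :=
    Finite.iff_fg.2 (homogeneousSubmodule_fg ..)
  rw [← finrank_homogeneousSubmodule k, ← homogeneousSubmodule_one_pow]
  conv_lhs => rw [hT, ← Submodule.map_pow]
  exact finrank_map_le _ _

theorem mul_smul_submodule (S T : Submodule k R) (M : Submodule k D) :
    (S * T) • M = S • T • M :=
  Submodule.smul_assoc S T M

theorem smul_submodule_comm (S T : Submodule k R) (M : Submodule k D) :
    S • T • M = T • S • M := by
  rw [← mul_smul_submodule, mul_comm, mul_smul_submodule]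

theorem span_singleton_smul_span_singleton (w : R) (F : D) :
    (k ∙ w) • (k ∙ F) = k ∙ (w • F) := by
  rw [smul_span_singleton, map_span, Set.image_singleton, orbitMap_apply]

section Lattice

variable {A T V : Submodule k R} {M N : Submodule k D}

theorem pow_succ_le_sup_mul (hV : A ⊔ T = V) (i : ℕ) :
    V ^ (i + 1) ≤ T ^ (i + 1) ⊔ A * V ^ i := by
  have hT : T ≤ V := hV ▸ le_sup_right
  induction i with
  | zero => simp [← hV, sup_comm]
  | succ i ih =>
    calc V ^ (i + 2) = (A ⊔ T) * V ^ (i + 1) := by rw [hV, pow_succ' V (i + 1)]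
      _ = A * V ^ (i + 1) ⊔ T * V ^ (i + 1) := Submodule.sup_mul _ _ _
      _ ≤ A * V ^ (i + 1) ⊔ T * (T ^ (i + 1) ⊔ A * V ^ i) := by gcongr
      _ = A * V ^ (i + 1) ⊔ (T ^ (i + 2) ⊔ A * (T * V ^ i)) := by
        rw [Submodule.mul_sup, ← pow_succ' T, mul_left_comm]
      _ ≤ A * V ^ (i + 1) ⊔ (T ^ (i + 2) ⊔ A * (V * V ^ i)) := by gcongr
      _ = T ^ (i + 2) ⊔ A * V ^ (i + 1) := by rw [← pow_succ', sup_comm, sup_assoc, sup_idem]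

theorem mul_pow_smul_le (h : A • M ≤ V • N) (i : ℕ) : (A * V ^ i) • M ≤ V ^ (i + 1) • N := by
  rw [mul_comm, mul_smul_submodule, pow_succ, mul_smul_submodule]
  exact smul_mono le_rfl h

theorem pow_succ_smul_le (h : V • M ≤ V • N) (i : ℕ) : V ^ (i + 1) • M ≤ V ^ (i + 1) • N := by
  rw [pow_succ']
  exact (mul_pow_smul_le h i).trans (by rw [pow_succ'])

theorem pow_succ_smul_le_sup (hV : A ⊔ T = V) (h : A • M ≤ V • N) (i : ℕ) :
    V ^ (i + 1) • M ≤ T ^ (i + 1) • M ⊔ V ^ (i + 1) • N :=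
  calc V ^ (i + 1) • M ≤ (T ^ (i + 1) ⊔ A * V ^ i) • M :=
        smul_mono_left (pow_succ_le_sup_mul hV i)
    _ = T ^ (i + 1) • M ⊔ (A * V ^ i) • M := Submodule.sup_smul _ _ _
    _ ≤ T ^ (i + 1) • M ⊔ V ^ (i + 1) • N := sup_le_sup_left (mul_pow_smul_le h i) _

end Lattice

theorem finrank_pow_smul_span_singleton_le (T : Submodule k R) [FiniteDimensional k T] (F : D)
    (i : ℕ) : finrank k (T ^ i • (k ∙ F) : Submodule k D) ≤ (finrank k T).multichoose i := by
  rw [smul_span_singleton]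
  exact (finrank_map_le _ _).trans (finrank_pow_le T i)

variable {V : Submodule k R} [FiniteDimensional k V]

theorem exists_sup_eq_smul_span_singleton_le (V : Submodule k R) [FiniteDimensional k V] (G : D)
    (N : Submodule k D) [FiniteDimensional k N] :
    ∃ A T : Submodule k R, FiniteDimensional k T ∧ A ⊔ T = V ∧ A • (k ∙ G) ≤ N ∧
      finrank k T + finrank k N = finrank k (V • (k ∙ G) ⊔ N : Submodule k D) := by
  let f : R →ₗ[k] D ⧸ N := N.mkQ ∘ₗ orbitMap k G
  obtain ⟨T, hTV, hT, hfin⟩ := exists_sup_eq_finrank_add (inf_le_left : V ⊓ LinearMap.ker f ≤ V)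
  refine ⟨V ⊓ LinearMap.ker f, T, finiteDimensional_of_le hTV, hT,
    smul_span_singleton_le.2 fun v hv => (Quotient.mk_eq_zero N).1 hv.2, ?_⟩
  have h := finrank_map_add_finrank_inf_ker f V
  rw [Submodule.map_comp, ← smul_span_singleton] at h
  rw [← finrank_map_mkQ_add_finrank]
  omega

theorem finrank_pow_succ_smul_le (V : Submodule k R) [FiniteDimensional k V] (F : D) (i : ℕ) :
    finrank k (V ^ (i + 1) • (k ∙ F) : Submodule k D) ≤
      (finrank k (V • (k ∙ F) : Submodule k D)).multichoose (i + 1) := by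
  obtain ⟨A, T, _, hV, hA, hT⟩ := exists_sup_eq_smul_span_singleton_le V F ⊥
  rw [finrank_bot, add_zero, sup_bot_eq] at hT
  have hle := pow_succ_smul_le_sup (N := ⊥) hV (hA.trans bot_le) i
  rw [smul_bot, sup_bot_eq] at hle
  exact hT ▸ (finrank_mono hle).trans (finrank_pow_smul_span_singleton_le T F _)

theorem finrank_pow_succ_smul_span_pair_le (V : Submodule k R) [FiniteDimensional k V] (F G : D)
    (i : ℕ) :
    finrank k (V ^ (i + 1) • span k {F, G} : Submodule k D) ≤
      (finrank k (V • (k ∙ F) : Submodule k D)).multichoose (i + 1) +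
      (finrank k (V • span k {F, G} : Submodule k D) -
        finrank k (V • (k ∙ F) : Submodule k D)).multichoose (i + 1) := by
  obtain ⟨A, T, _, hV, hA, hT⟩ := exists_sup_eq_smul_span_singleton_le V G (V • (k ∙ F))
  rw [sup_comm, ← smul_span_pair] at hT
  have hle : V ^ (i + 1) • span k {F, G} ≤ V ^ (i + 1) • (k ∙ F) ⊔ T ^ (i + 1) • (k ∙ G) := by
    rw [smul_span_pair]
    exact sup_le le_sup_left ((pow_succ_smul_le_sup hV hA i).trans (sup_comm _ _).le)
  rw [← hT, Nat.add_sub_cancel]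
  exact (finrank_mono hle).trans ((finrank_add_le_finrank_add_finrank _ _).trans
    (add_le_add (finrank_pow_succ_smul_le V F i) (finrank_pow_smul_span_singleton_le T G _)))

theorem finrank_pow_succ_smul_le_of_smul_eq_zero {F : D} {x : R} (hx : x ∈ V) (hx0 : x ≠ 0)
    (h : x • F = 0) (i : ℕ) :
    finrank k (V ^ (i + 1) • (k ∙ F) : Submodule k D) ≤
      (finrank k V - 1).multichoose (i + 1) := by
  refine (finrank_pow_succ_smul_le V F i).trans (multichoose_le_multichoose ?_ _)
  have hker : k ∙ x ≤ V ⊓ LinearMap.ker (orbitMap k F) :=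
    (span_singleton_le_iff_mem _ _).2 ⟨hx, h⟩
  have := finiteDimensional_of_le (inf_le_left : V ⊓ LinearMap.ker (orbitMap k F) ≤ V)
  have h1 := finrank_mono hker
  rw [finrank_span_singleton hx0] at h1
  have := finrank_map_add_finrank_inf_ker (orbitMap k F) V
  rw [smul_span_singleton]
  omega

theorem finrank_pow_succ_smul_span_pair_of_extension {A : Submodule k R} {F G : D} {x z : R}
    (hV : A ⊔ k ∙ z = V) (hx : x • F = 0) (hA : A • (k ∙ G) ≤ V • (k ∙ F)) {i : ℕ}
    (hi : x • z ^ (i + 1) • G ≠ 0) :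
    finrank k (V ^ (i + 1) • span k {F, G} : Submodule k D) =
      finrank k (V ^ (i + 1) • (k ∙ F) : Submodule k D) + 1 := by
  have hz : z ∈ V := hV ▸ mem_sup_right (mem_span_singleton_self z)
  have hzG : z ^ (i + 1) • G ∈ V ^ (i + 1) • (k ∙ G) :=
    smul_mem_smul (pow_mem_pow V hz _) (mem_span_singleton_self G)
  have heq : V ^ (i + 1) • span k {F, G} = V ^ (i + 1) • (k ∙ F) ⊔ k ∙ (z ^ (i + 1) • G) := by
    rw [smul_span_pair]
    refine le_antisymm (sup_le le_sup_left ((pow_succ_smul_le_sup hV hA i).trans ?_))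
      (sup_le_sup_left ((span_singleton_le_iff_mem _ _).2 hzG) _)
    rw [span_pow, Set.singleton_pow, sup_comm, span_singleton_smul_span_singleton]
  have hnotMem : z ^ (i + 1) • G ∉ V ^ (i + 1) • (k ∙ F) := fun h => by
    obtain ⟨v, -, hv⟩ := mem_smul_span_singleton.1 h
    exact hi (by rw [← hv, smul_comm, hx, smul_zero])
  have hlt := finrank_lt_finrank_sup_span hnotMem
  have hle := finrank_add_le_finrank_add_finrank (V ^ (i + 1) • (k ∙ F)) (k ∙ (z ^ (i + 1) • G))
  have hspan := finrank_span_singleton_le (k := k) (z ^ (i + 1) • G)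
  rw [heq]
  omega

theorem exists_linearIndependent_smul_eq {V : Submodule k R} {F G : D}
    (hF : ∀ v ∈ V, v • F = 0 → v = 0) (h : V • (k ∙ G) ≤ V • (k ∙ F))
    (hne : ∀ c : k, ∃ v ∈ V, v • G ≠ c • v • F) :
    ∃ v ∈ V, ∃ w ∈ V, LinearIndependent k ![v, w] ∧ v • G = w • F := by
  have hG (v : V) : (v : R) • G ∈ LinearMap.range ((orbitMap k F).domRestrict V) := by
    rw [LinearMap.range_domRestrict, ← smul_span_singleton]
    exact smul_span_singleton_le.1 h v v.2
  let e := LinearEquiv.ofInjective ((orbitMap k F).domRestrict V)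
    ((injective_iff_map_eq_zero _).2 fun v hv => Subtype.ext (hF v v.2 hv))
  let B : V →ₗ[k] V := e.symm.toLinearMap ∘ₗ ((orbitMap k G).domRestrict V).codRestrict _ hG
  have hB (v : V) : (B v : R) • F = (v : R) • G :=
    congrArg Subtype.val (e.apply_symm_apply ⟨(v : R) • G, hG v⟩)
  by_cases! hlin : ∀ v, ¬ LinearIndependent k ![v, B v]
  · obtain ⟨a, ha⟩ := LinearMap.exists_eq_smul_id_of_forall_notLinearIndependent hlin
    obtain ⟨v, hv, hva⟩ := hne a
    refine absurd ?_ hva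
    rw [← hB ⟨v, hv⟩, ha]
    simp
  · obtain ⟨v, hv⟩ := hlin
    refine ⟨v, v.2, B v, (B v).2, ?_, (hB v).symm⟩
    rw [LinearIndependent.pair_iff] at hv ⊢
    exact fun a b hab => hv a b (Subtype.ext hab)

/-- Since `w • V • F = V • v • G ≤ v • V • F`, a factor `w` can be traded for a factor `v` as long
as another factor from `V` is left. -/
theorem pow_succ_smul_le_sup_of_smul_eq {V T : Submodule k R} {F G : D}
    (h : V • (k ∙ G) ≤ V • (k ∙ F)) {v w : R} (hvT : v ∈ T) (hV : (k ∙ w) ⊔ T = V)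
    (hvG : v • G = w • F) (i : ℕ) :
    V ^ (i + 1) • (k ∙ F) ≤ T ^ (i + 1) • (k ∙ F) ⊔ k ∙ (v ^ i • w • F) := by
  have hwv : (k ∙ w) • V • (k ∙ F) ≤ (k ∙ v) • V • (k ∙ F) :=
    calc (k ∙ w) • V • (k ∙ F) = V • (k ∙ v) • (k ∙ G) := by
          rw [smul_submodule_comm, span_singleton_smul_span_singleton,
            span_singleton_smul_span_singleton, hvG]
      _ = (k ∙ v) • V • (k ∙ G) := smul_submodule_comm _ _ _
      _ ≤ (k ∙ v) • V • (k ∙ F) := smul_mono_right _ h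
  induction i with
  | zero => simp [← hV, Submodule.sup_smul, sup_comm, span_singleton_smul_span_singleton]
  | succ i ih =>
    calc V ^ (i + 2) • (k ∙ F)
        ≤ (T ^ (i + 2) ⊔ (k ∙ w) * V ^ (i + 1)) • (k ∙ F) :=
          smul_mono_left (pow_succ_le_sup_mul hV _)
      _ = T ^ (i + 2) • (k ∙ F) ⊔ V ^ i • (k ∙ w) • V • (k ∙ F) := by
          rw [Submodule.sup_smul, mul_smul_submodule, pow_succ V, mul_smul_submodule,
            smul_submodule_comm (k ∙ w)]
      _ ≤ T ^ (i + 2) • (k ∙ F) ⊔ V ^ i • (k ∙ v) • V • (k ∙ F) := by gcongr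
      _ = T ^ (i + 2) • (k ∙ F) ⊔ (k ∙ v) • V ^ (i + 1) • (k ∙ F) := by
          rw [smul_submodule_comm, pow_succ V, mul_smul_submodule]
      _ ≤ T ^ (i + 2) • (k ∙ F) ⊔ (k ∙ v) • (T ^ (i + 1) • (k ∙ F) ⊔ k ∙ (v ^ i • w • F)) := by
          gcongr
      _ = T ^ (i + 2) • (k ∙ F) ⊔ ((k ∙ v) * T ^ (i + 1)) • (k ∙ F) ⊔
            k ∙ (v ^ (i + 1) • w • F) := by
          rw [Submodule.smul_sup, span_singleton_smul_span_singleton, smul_smul, ← pow_succ',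
            sup_assoc, mul_smul_submodule]
      _ ≤ T ^ (i + 2) • (k ∙ F) ⊔ k ∙ (v ^ (i + 1) • w • F) := by
          refine sup_le_sup_right (sup_le le_rfl (smul_mono_left ?_)) _
          rw [pow_succ' T (i + 1)]
          gcongr
          exact (span_singleton_le_iff_mem _ _).2 hvT

theorem finrank_pow_succ_smul_le_of_linearIndependent {F G : D} (h : V • (k ∙ G) ≤ V • (k ∙ F))
    {v w : R} (hv : v ∈ V) (hw : w ∈ V) (hvw : LinearIndependent k ![v, w])
    (hvG : v • G = w • F) (i : ℕ) :
    finrank k (V ^ (i + 1) • (k ∙ F) : Submodule k D) ≤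
      (finrank k V - 1).multichoose (i + 1) + 1 := by
  have hK : span k {v, w} ≤ V := span_le.2 (by simp [Set.insert_subset_iff, hv, hw])
  obtain ⟨T, hTV, hT, hfin⟩ := exists_sup_eq_finrank_add hK
  have := finiteDimensional_of_le hTV
  have hrank : finrank k (span k {v, w}) = 2 := by
    rw [← Matrix.range_cons_cons_empty v w ![], finrank_span_eq_card hvw, Fintype.card_fin]
  have hVT : (k ∙ w) ⊔ ((k ∙ v) ⊔ T) = V := by
    rw [← sup_assoc, sup_comm (k ∙ w), ← span_union, Set.singleton_union, hT]
  have hle := pow_succ_smul_le_sup_of_smul_eq h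
    (mem_sup_left (mem_span_singleton_self v)) hVT hvG i
  have hfinT : finrank k ((k ∙ v) ⊔ T : Submodule k R) ≤ finrank k V - 1 := by
    have := finrank_add_le_finrank_add_finrank (k ∙ v) T
    have := finrank_span_singleton_le (k := k) v
    omega
  exact (finrank_mono hle).trans ((finrank_add_le_finrank_add_finrank _ _).trans
    (add_le_add ((finrank_pow_smul_span_singleton_le _ F _).trans
      (multichoose_le_multichoose hfinT _)) (finrank_span_singleton_le _)))

end Powers

/-! ### Macaulay duality -/

section Duality

variable {k : Type*} [Field k] {r : ℕ}

/-- The space of forms of degree `d` in `r` variables. -/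
abbrev forms (k : Type*) [Field k] (r d : ℕ) : Submodule k (MvPolynomial (Fin r) k) :=
  homogeneousSubmodule (Fin r) k d

instance (d : ℕ) : FiniteDimensional k (forms k r d) :=
  Finite.iff_fg.2 (homogeneousSubmodule_fg ..)

/-- The `k`-linear functionals on the polynomial ring. Graded duals take the place of divided
powers in Macaulay's inverse systems. -/
abbrev Functional (k : Type*) [Field k] (r : ℕ) : Type _ :=
  Dual k (MvPolynomial (Fin r) k)

/-- Polynomials act on functionals by contraction, `(p • φ) q = φ (p * q)`. -/
instance contraction : Module (MvPolynomial (Fin r) k) (Functional k r) where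
  smul p φ := φ ∘ₗ LinearMap.mulLeft k p
  one_smul φ := LinearMap.ext fun q => congrArg φ (one_mul q)
  mul_smul p q φ := LinearMap.ext fun m => congrArg φ ((congrArg (· * m) (mul_comm p q)).trans
    (mul_assoc q p m))
  smul_zero _ := rfl
  smul_add _ _ _ := rfl
  add_smul p q φ := LinearMap.ext fun m =>
    (congrArg φ (add_mul p q m)).trans (map_add φ (p * m) (q * m))
  zero_smul φ := LinearMap.ext fun m => (congrArg φ (zero_mul m)).trans (map_zero φ)

theorem contract_apply (p q : MvPolynomial (Fin r) k) (φ : Functional k r) :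
    (p • φ) q = φ (p * q) := rfl

theorem contract_apply_comm (p q : MvPolynomial (Fin r) k) (φ : Functional k r) :
    (p • φ) q = (q • φ) p := congrArg φ (mul_comm p q)

theorem contract_apply_one (p : MvPolynomial (Fin r) k) (φ : Functional k r) :
    (p • φ) 1 = φ p := congrArg φ (mul_one p)

instance : IsScalarTower k (MvPolynomial (Fin r) k) (Functional k r) where
  smul_assoc c p φ := LinearMap.ext fun m => by
    rw [contract_apply, LinearMap.smul_apply, contract_apply, smul_mul_assoc, map_smul]

theorem functional_ext {φ ψ : Functional k r} (h : ∀ d, ∀ q ∈ forms k r d, φ q = ψ q) :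
    φ = ψ := by
  refine LinearMap.ext fun p => ?_
  rw [← sum_homogeneousComponent p, map_sum, map_sum]
  exact Finset.sum_congr rfl fun i _ => h i _ (homogeneousComponent_mem i p)

/-- The functionals concentrated in degree `e`: the graded dual of the forms of degree `e`. -/
def functionals (k : Type*) [Field k] (r e : ℕ) : Submodule k (Functional k r) :=
  ⨅ d ≠ e, (forms k r d).dualAnnihilator

theorem mem_functionals {e : ℕ} {φ : Functional k r} :
    φ ∈ functionals k r e ↔ ∀ d ≠ e, ∀ q ∈ forms k r d, φ q = 0 := by
  simp only [functionals, mem_iInf, mem_dualAnnihilator]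

theorem eq_of_mem_functionals {e : ℕ} {φ ψ : Functional k r} (hφ : φ ∈ functionals k r e)
    (hψ : ψ ∈ functionals k r e) (h : ∀ q ∈ forms k r e, φ q = ψ q) : φ = ψ :=
  functional_ext fun d q hq => by
    obtain rfl | hd := eq_or_ne d e
    · exact h q hq
    · rw [mem_functionals.1 hφ d hd q hq, mem_functionals.1 hψ d hd q hq]

theorem comp_homogeneousComponent_mem_functionals (φ : Functional k r) (e : ℕ) :
    φ ∘ₗ homogeneousComponent e ∈ functionals k r e :=
  mem_functionals.2 fun d hd q hq => by
    rw [LinearMap.comp_apply, homogeneousComponent_of_mem hq, if_neg hd.symm, map_zero]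

theorem dualRestrict_domRestrict_functionals_injective (d : ℕ) :
    Function.Injective ((forms k r d).dualRestrict.domRestrict (functionals k r d)) :=
  fun φ ψ h => Subtype.ext <|
    eq_of_mem_functionals φ.2 ψ.2 fun q hq => LinearMap.congr_fun h ⟨q, hq⟩

instance (d : ℕ) : FiniteDimensional k (functionals k r d) :=
  Module.Finite.of_injective _ (dualRestrict_domRestrict_functionals_injective d)

theorem contract_mem_functionals {i j e : ℕ} (hij : i + j = e) {p : MvPolynomial (Fin r) k}
    (hp : p ∈ forms k r i) {φ : Functional k r} (hφ : φ ∈ functionals k r e) :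
    p • φ ∈ functionals k r j :=
  mem_functionals.2 fun d hd q hq =>
    mem_functionals.1 hφ (i + d) (by omega) _ (IsHomogeneous.mul hp hq)

theorem contract_eq_zero {i e : ℕ} (hi : e < i) {p : MvPolynomial (Fin r) k}
    (hp : p ∈ forms k r i) {φ : Functional k r} (hφ : φ ∈ functionals k r e) : p • φ = 0 :=
  functional_ext fun d q hq =>
    mem_functionals.1 hφ (i + d) (by omega) _ (IsHomogeneous.mul hp hq)

theorem forms_smul_le_functionals {i j e : ℕ} (hij : i + j = e) {W : Submodule k (Functional k r)}
    (hW : W ≤ functionals k r e) : forms k r i • W ≤ functionals k r j :=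
  smul_le.2 fun _ hp _ hφ => contract_mem_functionals hij hp (hW hφ)

theorem homogeneousComponent_contract_apply {i j e : ℕ} (hij : i + j = e) {φ : Functional k r}
    (hφ : φ ∈ functionals k r e) (p : MvPolynomial (Fin r) k) {q : MvPolynomial (Fin r) k}
    (hq : q ∈ forms k r j) : (homogeneousComponent i p • φ) q = (p • φ) q := by
  have hzero : ∀ d ≠ i, (homogeneousComponent d p • φ) q = 0 := fun d hd =>
    mem_functionals.1 hφ (d + j) (by omega) _
      (IsHomogeneous.mul (homogeneousComponent_mem d p) hq)
  conv_rhs => rw [← sum_homogeneousComponent p, Finset.sum_smul, LinearMap.sum_apply]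
  refine (Finset.sum_eq_single i (fun d _ => hzero d) fun hi => ?_).symm
  rw [homogeneousComponent_eq_zero i p (by rw [Finset.mem_range] at hi; omega), zero_smul,
    LinearMap.zero_apply]

theorem homogeneousComponent_contract_eq_zero {e : ℕ} {φ : Functional k r}
    (hφ : φ ∈ functionals k r e) {p : MvPolynomial (Fin r) k} (hp : p • φ = 0) (i : ℕ) :
    homogeneousComponent i p • φ = 0 := functional_ext fun d q hq => by
  by_cases hd : i + d = e
  · rw [homogeneousComponent_contract_apply hd hφ p hq, hp]
  · exact mem_functionals.1 hφ (i + d) hd _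
      (IsHomogeneous.mul (homogeneousComponent_mem i p) hq)

theorem eq_zero_of_X_contract {d : ℕ} {φ : Functional k r} (hφ : φ ∈ functionals k r (d + 1))
    (h : ∀ j, (X j : MvPolynomial (Fin r) k) • φ = 0) : φ = 0 := by
  refine eq_of_mem_functionals hφ (Submodule.zero_mem _) fun q hq => ?_
  rw [forms, ← homogeneousSubmodule_one_pow, pow_succ', homogeneousSubmodule_one_eq_span_X] at hq
  have hlin : span k (Set.range X) ≤
      LinearMap.ker (orbitMap (R := MvPolynomial (Fin r) k) k φ) := by
    rw [span_le, Set.range_subset_iff]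
    exact h
  induction hq using Submodule.mul_induction_on' with
  | mem_mul_mem v hv m hm =>
    rw [← contract_apply, show v • φ = 0 from hlin hv, LinearMap.zero_apply, LinearMap.zero_apply]
  | add y _ z _ hy hz => rw [map_add, hy, hz, map_add]

/-- The ideal of polynomials contracting every functional in `W` to zero: the ideal with inverse
system generated by `W`. -/
def apolarIdeal (W : Submodule k (Functional k r)) : Ideal (MvPolynomial (Fin r) k) :=
  (span (MvPolynomial (Fin r) k) (W : Set (Functional k r))).annihilator

theorem mem_apolarIdeal {W : Submodule k (Functional k r)} {p : MvPolynomial (Fin r) k} :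
    p ∈ apolarIdeal W ↔ ∀ φ ∈ W, p • φ = 0 := by
  rw [apolarIdeal, mem_annihilator_span]
  exact Subtype.forall

theorem mem_apolarIdeal_span_pair {F G : Functional k r} {p : MvPolynomial (Fin r) k} :
    p ∈ apolarIdeal (span k {F, G}) ↔ p • F = 0 ∧ p • G = 0 := by
  rw [mem_apolarIdeal]
  refine ⟨fun h => ⟨h F (subset_span (by simp)), h G (subset_span (by simp))⟩, ?_⟩
  rintro ⟨hF, hG⟩ φ hφ
  obtain ⟨a, b, rfl⟩ := mem_span_pair.1 hφ
  rw [smul_add, smul_comm, hF, smul_comm p, hG, smul_zero, smul_zero, add_zero]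

theorem forms_inf_apolarIdeal {i d e : ℕ} (hid : i + d = e) {W : Submodule k (Functional k r)}
    (hW : W ≤ functionals k r e) :
    forms k r d ⊓ (apolarIdeal W).restrictScalars k =
      forms k r d ⊓ (forms k r i • W).dualCoannihilator := by
  ext q
  simp only [mem_inf, restrictScalars_mem, mem_apolarIdeal, mem_dualCoannihilator]
  refine and_congr_right fun hq => ⟨fun h φ hφ => ?_, fun h φ hφ => ?_⟩
  · refine smul_induction_on hφ (fun p _ ψ hψ => ?_) fun x y hx hy => ?_
    · rw [contract_apply_comm, h ψ hψ, LinearMap.zero_apply]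
    · rw [LinearMap.add_apply, hx, hy, add_zero]
  · refine eq_of_mem_functionals (contract_mem_functionals (by omega : d + i = e) hq (hW hφ))
      (Submodule.zero_mem _) fun p hp => ?_
    rw [contract_apply_comm]
    exact h _ (smul_mem_smul hp hφ)

theorem finrank_add_finrank_inf_dualCoannihilator {d : ℕ} {N : Submodule k (Functional k r)}
    (hN : N ≤ functionals k r d) :
    finrank k N + finrank k (forms k r d ⊓ N.dualCoannihilator : Submodule k _) =
      finrank k (forms k r d) := by
  have hmap : finrank k (N.map (forms k r d).dualRestrict) = finrank k N := by
    rw [← LinearMap.range_domRestrict]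
    exact LinearMap.finrank_range_of_inj fun φ ψ h => Subtype.ext <|
      eq_of_mem_functionals (hN φ.2) (hN ψ.2) fun q hq => LinearMap.congr_fun h ⟨q, hq⟩
  have hco : forms k r d ⊓ N.dualCoannihilator = Submodule.map (forms k r d).subtype
      (N.map (forms k r d).dualRestrict).dualCoannihilator := by
    ext q
    simp [mem_dualCoannihilator, and_comm]
  rw [← Subspace.finrank_add_finrank_dualCoannihilator_eq (N.map (forms k r d).dualRestrict), hmap,
    hco, finrank_map_subtype_eq]

theorem hVector_add_finrank (I : Ideal (MvPolynomial (Fin r) k)) (d : ℕ) :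
    hVector I d + finrank k (forms k r d ⊓ I.restrictScalars k : Submodule k _) =
      finrank k (forms k r d) := by
  have hker : I.restrictScalars k = LinearMap.ker (Ideal.Quotient.mkₐ k I).toLinearMap := by
    ext q
    simp [Ideal.Quotient.eq_zero_iff_mem]
  rw [hker]
  exact finrank_map_add_finrank_inf_ker (Ideal.Quotient.mkₐ k I).toLinearMap (forms k r d)

theorem hVector_apolarIdeal {i d e : ℕ} (hid : i + d = e) {W : Submodule k (Functional k r)}
    (hW : W ≤ functionals k r e) :
    hVector (apolarIdeal W) d = finrank k (forms k r i • W : Submodule k (Functional k r)) := by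
  have hI := hVector_add_finrank (apolarIdeal W) d
  have hN := finrank_add_finrank_inf_dualCoannihilator (forms_smul_le_functionals hid hW)
  rw [forms_inf_apolarIdeal hid hW] at hI
  omega

theorem finrank_forms_smul_span_singleton_symm {i d e : ℕ} (hid : i + d = e) {F : Functional k r}
    (hF : F ∈ functionals k r e) :
    finrank k (forms k r i • (k ∙ F) : Submodule k (Functional k r)) =
      finrank k (forms k r d • (k ∙ F) : Submodule k (Functional k r)) := by
  have hker : (apolarIdeal (k ∙ F)).restrictScalars k = LinearMap.ker (orbitMap k F) := by
    ext q
    rw [restrictScalars_mem, ← Set.pair_eq_singleton, mem_apolarIdeal_span_pair, and_self]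
    rfl
  have hI := hVector_add_finrank (apolarIdeal (k ∙ F)) d
  have hd := finrank_map_add_finrank_inf_ker (orbitMap k F) (forms k r d)
  rw [hker] at hI
  rw [← hVector_apolarIdeal hid ((span_singleton_le_iff_mem _ _).2 hF), smul_span_singleton]
  omega

end Duality

section Level

variable {k : Type*} [Field k] {r : ℕ} {I : Ideal (MvPolynomial (Fin r) k)} {e t : ℕ}

instance (d : ℕ) : FiniteDimensional k (gradedPiece I d) := by
  unfold gradedPiece
  infer_instance

theorem mem_gradedPiece {d : ℕ} {a : MvPolynomial (Fin r) k ⧸ I} :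
    a ∈ gradedPiece I d ↔ ∃ p ∈ forms k r d, Ideal.Quotient.mk I p = a := Iff.rfl

theorem mk_mem_gradedPiece {d : ℕ} {p : MvPolynomial (Fin r) k} (hp : p ∈ forms k r d) :
    Ideal.Quotient.mk I p ∈ gradedPiece I d := mem_gradedPiece.2 ⟨p, hp, rfl⟩

theorem mk_mem_socle {p : MvPolynomial (Fin r) k} :
    Ideal.Quotient.mk I p ∈ socle I ↔ ∀ j, p * X j ∈ I := by
  rw [socle, maxHomIdeal, Ideal.span, mem_annihilator_span]
  simp [← map_mul, Ideal.Quotient.eq_zero_iff_mem]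

theorem hVector_eq_zero_iff {d : ℕ} : hVector I d = 0 ↔ ∀ p ∈ forms k r d, p ∈ I := by
  rw [hVector, Submodule.finrank_eq_zero, eq_bot_iff, gradedPiece, map_le_iff_le_comap]
  simp only [SetLike.le_def, mem_comap, mem_bot, AlgHom.toLinearMap_apply,
    Ideal.Quotient.mkₐ_eq_mk, Ideal.Quotient.eq_zero_iff_mem]

theorem socleVector_eq_zero_iff {d : ℕ} :
    socleVector I d = 0 ↔ ∀ p ∈ forms k r d, (∀ j, p * X j ∈ I) → p ∈ I := by
  have : FiniteDimensional k ((socle I).restrictScalars k ⊓ gradedPiece I d : Submodule k _) :=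
    finiteDimensional_of_le inf_le_right
  simp only [socleVector, Submodule.finrank_eq_zero, eq_bot_iff, SetLike.le_def, mem_inf,
    restrictScalars_mem, mem_bot, and_imp]
  refine ⟨fun h p hp hpX => Ideal.Quotient.eq_zero_iff_mem.1
    (h (mk_mem_socle.2 hpX) (mk_mem_gradedPiece hp)), fun h a ha had => ?_⟩
  obtain ⟨p, hp, rfl⟩ := mem_gradedPiece.1 had
  exact Ideal.Quotient.eq_zero_iff_mem.2 (h p hp (mk_mem_socle.1 ha))

theorem socleVector_eq_hVector (h : hVector I (e + 1) = 0) : socleVector I e = hVector I e := by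
  rw [socleVector, hVector, inf_eq_right.2]
  intro a ha
  obtain ⟨p, hp, rfl⟩ := mem_gradedPiece.1 ha
  exact mk_mem_socle.2 fun j =>
    hVector_eq_zero_iff.1 h _ (IsHomogeneous.mul hp (isHomogeneous_X k j))

theorem IsLevel.hVector_top (h : IsLevel I e t) : hVector I e = t := by
  rw [← socleVector_eq_hVector (h.eq_zero_above _ e.lt_succ_self), h.socleVector_eq, if_pos rfl]

theorem IsLevel.mem_of_mem_apolarIdeal (h : IsLevel I e t) {d : ℕ} (hd : d ≤ e)
    {p : MvPolynomial (Fin r) k} (hp : p ∈ forms k r d)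
    (hpW : p ∈ apolarIdeal (functionals k r e ⊓ (I.restrictScalars k).dualAnnihilator)) :
    p ∈ I := by
  induction hd using Nat.decreasingInduction generalizing p with
  | self =>
    by_contra hpI
    obtain ⟨f, hfp, hf⟩ := exists_le_ker_of_notMem (p := I.restrictScalars k) hpI
    have hmem : f ∘ₗ homogeneousComponent e ∈ (I.restrictScalars k).dualAnnihilator :=
      (mem_dualAnnihilator _).2 fun q hq => hf (homogeneousComponent_mem_of_mem h.homogeneous hq e)
    have hpf := LinearMap.congr_fun (mem_apolarIdeal.1 hpW _
      ⟨comp_homogeneousComponent_mem_functionals f e, hmem⟩) 1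
    rw [contract_apply_one, LinearMap.comp_apply, homogeneousComponent_eq_self hp] at hpf
    exact hfp hpf
  | of_succ d hd ih =>
    exact socleVector_eq_zero_iff.1 ((h.socleVector_eq d).trans (if_neg (by omega))) p hp fun j =>
      ih (IsHomogeneous.mul hp (isHomogeneous_X k j)) (Ideal.mul_mem_right _ _ hpW)

theorem IsLevel.exists_eq_apolarIdeal (h : IsLevel I e t) :
    ∃ W ≤ functionals k r e, finrank k W = t ∧ apolarIdeal W = I := by
  let W := functionals k r e ⊓ (I.restrictScalars k).dualAnnihilator
  have hW : W ≤ functionals k r e := inf_le_left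
  have hle : I ≤ apolarIdeal W := fun p hp => mem_apolarIdeal.2 fun φ hφ =>
    LinearMap.ext fun q => (mem_dualAnnihilator φ).1 hφ.2 _ (I.mul_mem_right q hp)
  have heq : apolarIdeal W = I := by
    refine le_antisymm (fun p hp => ?_) hle
    rw [mem_iff_homogeneousComponent_mem h.homogeneous]
    intro d
    obtain hd | hd := le_or_gt d e
    · exact h.mem_of_mem_apolarIdeal hd (homogeneousComponent_mem d p) (mem_apolarIdeal.2
        fun φ hφ => homogeneousComponent_contract_eq_zero (hW hφ) (mem_apolarIdeal.1 hp φ hφ) d)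
    · exact hVector_eq_zero_iff.1 (h.eq_zero_above d hd) _ (homogeneousComponent_mem d p)
  refine ⟨W, hW, ?_, heq⟩
  rw [← h.hVector_top, ← heq, hVector_apolarIdeal (zero_add e) hW, forms, homogeneousSubmodule_zero,
    Submodule.one_smul]

theorem apolarIdeal_isHomogeneous {W : Submodule k (Functional k r)} (hW : W ≤ functionals k r e) :
    (apolarIdeal W).IsHomogeneous (homogeneousSubmodule (Fin r) k) := by
  intro i p hp
  rw [mem_apolarIdeal] at hp
  have hi : ((DirectSum.decompose (homogeneousSubmodule (Fin r) k) p i :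
      homogeneousSubmodule (Fin r) k i) : MvPolynomial (Fin r) k) = homogeneousComponent i p :=
    decomposition.decompose'_apply p i
  rw [hi, mem_apolarIdeal]
  exact fun φ hφ => homogeneousComponent_contract_eq_zero (hW hφ) (hp φ hφ) i

theorem isArtinianRing_quotient (h : ∀ d, e < d → hVector I d = 0) :
    IsArtinianRing (MvPolynomial (Fin r) k ⧸ I) := by
  have htop : ⨆ d : Fin (e + 1), gradedPiece I d = ⊤ := by
    refine eq_top_iff.2 fun a _ => ?_
    obtain ⟨p, rfl⟩ := Ideal.Quotient.mk_surjective a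
    rw [← sum_homogeneousComponent p, map_sum]
    refine Submodule.sum_mem _ fun d _ => ?_
    by_cases hd : d < e + 1
    · exact mem_iSup_of_mem (⟨d, hd⟩ : Fin (e + 1))
        (mk_mem_gradedPiece (homogeneousComponent_mem d p))
    · rw [Ideal.Quotient.eq_zero_iff_mem.2
        (hVector_eq_zero_iff.1 (h d (by omega)) _ (homogeneousComponent_mem d p))]
      exact Submodule.zero_mem _
  have hfin : Module.Finite k (MvPolynomial (Fin r) k ⧸ I) :=
    finite_def.2 (htop ▸ Finite.iff_fg.1 inferInstance)
  exact IsArtinianRing.of_finite k _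

theorem isLevel_apolarIdeal {W : Submodule k (Functional k r)} (hW : W ≤ functionals k r e)
    (h0 : W ≠ ⊥) (h1 : ∀ x ∈ forms k r 1, x ∈ apolarIdeal W → x = 0) :
    IsLevel (apolarIdeal W) e (finrank k W) := by
  have := finiteDimensional_of_le hW
  have htop : hVector (apolarIdeal W) e = finrank k W := by
    rw [hVector_apolarIdeal (zero_add e) hW, forms, homogeneousSubmodule_zero, Submodule.one_smul]
  have habove (d : ℕ) (hd : e < d) : hVector (apolarIdeal W) d = 0 :=
    hVector_eq_zero_iff.2 fun p hp => mem_apolarIdeal.2 fun φ hφ => contract_eq_zero hd hp (hW hφ)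
  refine { homogeneous := apolarIdeal_isHomogeneous hW
           artinian := isArtinianRing_quotient habove
           no_linear_form := fun f hf hf1 => h1 f hf1 hf
           top_ne_zero := by rwa [htop, Ne, Submodule.finrank_eq_zero]
           eq_zero_above := habove
           socleVector_eq := fun d => ?_ }
  obtain hd | rfl | hd := lt_trichotomy d e
  · rw [if_neg hd.ne, socleVector_eq_zero_iff]
    intro p hp hpX
    obtain ⟨n, rfl⟩ := Nat.exists_eq_add_of_lt hd
    refine mem_apolarIdeal.2 fun φ hφ => eq_zero_of_X_contract (d := n)
      (contract_mem_functionals (by omega) hp (hW hφ)) fun j => ?_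
    rw [← mul_smul, mul_comm, mem_apolarIdeal.1 (hpX j) φ hφ]
  · rw [if_pos rfl, socleVector_eq_hVector (habove _ d.lt_succ_self), htop]
  · rw [if_neg hd.ne', socleVector_eq_zero_iff]
    exact fun p hp _ => hVector_eq_zero_iff.1 (habove d hd) p hp

end Level

/-! ### Upper bounds -/

section Pencil

variable {k R D : Type*} [Field k] [CommRing R] [Algebra k R] [AddCommGroup D] [Module k D]
  [Module R D] [IsScalarTower k R D]

theorem Nondegenerate.exists_finrank_pow_succ_smul_eq [Infinite k] {V : Submodule k R}
    [FiniteDimensional k V] {F G : D} {m : ℕ} {ε : D →ₗ[k] k} (hN : Nondegenerate V F G m ε)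
    (hm : 3 ≤ m) (hV : finrank k V ≤ 5)
    (hne : ∀ b c : k, ∃ v ∈ V, v • G ≠ b • v • (F + c • G)) :
    ∃ (c : k) (δ : ℕ), ∀ i < m, finrank k (V ^ (i + 1) • span k {F, G} : Submodule k D) =
        finrank k (V ^ (i + 1) • (k ∙ (F + c • G)) : Submodule k D) + δ ∧
      finrank k (V ^ (i + 1) • span k {F, G} : Submodule k D) ≤
        (finrank k V - 1).multichoose (i + 1) + 1 := by
  obtain ⟨c, ⟨hinj, hle⟩ | ⟨A, x, z, hx, hx0, hA, hxF, hAG, hz⟩⟩ := hN.dichotomy hm hV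
  · refine ⟨c, 0, fun i _ => ?_⟩
    obtain ⟨v, hv, w, hw, hvw, hvG⟩ := exists_linearIndependent_smul_eq hinj hle (hne · c)
    rw [← span_pair_add_smul F G c, smul_span_pair, sup_eq_left.2 (pow_succ_smul_le hle i)]
    exact ⟨rfl, finrank_pow_succ_smul_le_of_linearIndependent hle hv hw hvw hvG i⟩
  · refine ⟨c, 1, fun i hi => ?_⟩
    rw [← span_pair_add_smul F G c,
      finrank_pow_succ_smul_span_pair_of_extension hA hxF hAG (hz (i + 1) hi)]
    exact ⟨rfl, Nat.add_le_add_right (finrank_pow_succ_smul_le_of_smul_eq_zero hx hx0 hxF i) 1⟩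

end Pencil

section UpperBounds

variable {k : Type*} [Field k] {r e : ℕ} {I : Ideal (MvPolynomial (Fin r) k)}

theorem multichoose_add_multichoose_le {b t : ℕ} (h : b ≤ t) (n i : ℕ) :
    (b + n).multichoose i + t.multichoose i ≤ (t + n).multichoose i + b.multichoose i := by
  cases i with
  | zero => simp
  | succ i =>
    induction n with
    | zero => simp [add_comm]
    | succ n ih =>
      rw [← add_assoc, ← add_assoc, Nat.multichoose_succ_succ, Nat.multichoose_succ_succ]
      have := multichoose_le_multichoose (show b + n + 1 ≤ t + n + 1 by omega) i
      omega

theorem forms_one_pow (i : ℕ) : forms k r 1 ^ i = forms k r i :=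
  homogeneousSubmodule_one_pow ..

theorem finrank_forms_one (k : Type*) [Field k] (r : ℕ) : finrank k (forms k r 1) = r := by
  rw [finrank_homogeneousSubmodule, Nat.multichoose_one_right]

theorem span_pair_le_functionals {F G : Functional k r} (hF : F ∈ functionals k r e)
    (hG : G ∈ functionals k r e) : span k {F, G} ≤ functionals k r e :=
  span_le.2 (Set.insert_subset hF (Set.singleton_subset_iff.2 hG))

theorem hVector_le (I : Ideal (MvPolynomial (Fin r) k)) (d : ℕ) :
    hVector I d ≤ r.multichoose d := by
  rw [← finrank_homogeneousSubmodule k, ← hVector_add_finrank I d]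
  exact Nat.le_add_right _ _

theorem IsLevel.exists_eq_apolarIdeal_span_pair (h : IsLevel I e 2) :
    ∃ F ∈ functionals k r e, ∃ G ∈ functionals k r e,
      finrank k (span k {F, G}) = 2 ∧ apolarIdeal (span k {F, G}) = I := by
  obtain ⟨W, hW, hrank, rfl⟩ := h.exists_eq_apolarIdeal
  obtain ⟨F, hF, G, hG, hspan⟩ := exists_span_pair_eq_of_finrank_eq_two hrank
  exact ⟨F, hW hF, G, hW hG, hspan.symm ▸ hrank, by rw [hspan]⟩

theorem IsLevel.hVector_le_of_lt (h : IsLevel I e 2) (hr : r ≤ hVector I (e - 1)) {i : ℕ}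
    (hi : 1 ≤ i) (hie : i ≤ e) :
    hVector I (e - i) ≤ min (r.multichoose i + (hVector I (e - 1) - r).multichoose i)
      (r.multichoose (e - i)) := by
  refine le_min ?_ (hVector_le I _)
  obtain ⟨F, hF, G, hG, -, rfl⟩ := h.exists_eq_apolarIdeal_span_pair
  have hW := span_pair_le_functionals hF hG
  obtain ⟨j, rfl⟩ := Nat.exists_eq_add_of_le' hi
  rw [hVector_apolarIdeal (by omega : j + 1 + (e - (j + 1)) = e) hW]
  rw [hVector_apolarIdeal (by omega : 1 + (e - 1) = e) hW] at hr ⊢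
  have hbound := finrank_pow_succ_smul_span_pair_le (forms k r 1) F G j
  rw [forms_one_pow] at hbound
  have hF1 := finrank_pow_smul_span_singleton_le (forms k r 1) F 1
  have hG1 := finrank_pow_smul_span_singleton_le (forms k r 1) G 1
  have hsum := finrank_add_le_finrank_add_finrank (forms k r 1 • (k ∙ F)) (forms k r 1 • (k ∙ G))
  have hFle := finrank_mono (smul_mono_right (forms k r 1)
    (span_mono (Set.singleton_subset_iff.2 (Set.mem_insert F {G}))) :
    forms k r 1 • (k ∙ F) ≤ forms k r 1 • span k {F, G})
  rw [pow_one, Nat.multichoose_one_right, finrank_forms_one] at hF1 hG1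
  rw [← smul_span_pair] at hsum
  set s := finrank k (forms k r 1 • (k ∙ F) : Submodule k (Functional k r))
  set a := finrank k (forms k r 1 • span k {F, G} : Submodule k (Functional k r))
  -- Passing from `s + (a - s)` to the more unequal splitting `r + (a - r)` increases the bound.
  have hconvex := multichoose_add_multichoose_le (show a - r ≤ a - s by omega) (r - (a - s)) (j + 1)
  rw [show a - r + (r - (a - s)) = s by omega, show a - s + (r - (a - s)) = r by omega] at hconvex
  exact hbound.trans hconvex

theorem exists_contract_ne (he : 1 ≤ e) {F G : Functional k r} (hF : F ∈ functionals k r e)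
    (hG : G ∈ functionals k r e) (hFG : finrank k (span k {F, G}) = 2) (c : k) :
    ∃ v ∈ forms k r 1, v • G ≠ c • v • F := by
  by_contra! hcon
  obtain ⟨d, rfl⟩ := Nat.exists_eq_add_of_le' he
  have hzero : G - c • F = 0 := eq_zero_of_X_contract (sub_mem hG (smul_mem _ _ hF)) fun j => by
    rw [smul_sub, hcon _ (isHomogeneous_X k j), smul_comm, sub_self]
  have hle : span k {F, G} ≤ k ∙ F := by
    rw [span_le, Set.insert_subset_iff, Set.singleton_subset_iff, sub_eq_zero.1 hzero]
    exact ⟨mem_span_singleton_self F, smul_mem _ c (mem_span_singleton_self F)⟩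
  have := (finrank_mono hle).trans (finrank_span_singleton_le F)
  omega

theorem IsLevel.nondegenerate (he : 1 ≤ e) {F G : Functional k r} (hF : F ∈ functionals k r e)
    (hG : G ∈ functionals k r e) {t : ℕ} (h : IsLevel (apolarIdeal (span k {F, G})) e t)
    (hr : hVector (apolarIdeal (span k {F, G})) (e - 1) = r) :
    Nondegenerate (forms k r 1) F G (e - 1) (LinearMap.applyₗ 1) where
  eq_zero P hP h0 := by
    rw [forms_one_pow] at h0
    refine eq_of_mem_functionals (forms_smul_le_functionals (by omega : 1 + (e - 1) = e)
      (span_pair_le_functionals hF hG) hP) (Submodule.zero_mem _) fun q hq => ?_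
    rw [← contract_apply_one, LinearMap.zero_apply]
    exact h0 q hq
  faithful v hv hvF hvG := h.no_linear_form v (mem_apolarIdeal_span_pair.2 ⟨hvF, hvG⟩) hv
  finrank_eq := by
    rw [finrank_forms_one, ← hVector_apolarIdeal (by omega : 1 + (e - 1) = e)
      (span_pair_le_functionals hF hG), hr]

theorem IsLevel.exists_gorenstein [Infinite k] (he : 4 ≤ e) (hr5 : r ≤ 5) (h : IsLevel I e 2)
    (hr : hVector I (e - 1) = r) :
    ∃ F ∈ functionals k r e, ∃ δ : ℕ, ∀ i, 1 ≤ i → i ≤ e - 1 →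
      hVector I (e - i) = finrank k (forms k r i • (k ∙ F) : Submodule k (Functional k r)) + δ ∧
      hVector I (e - i) ≤ (r - 1).multichoose i + 1 := by
  obtain ⟨F, hF, G, hG, hFG, rfl⟩ := h.exists_eq_apolarIdeal_span_pair
  have hmem (c : k) : F + c • G ∈ functionals k r e := add_mem hF (smul_mem _ _ hG)
  obtain ⟨c, δ, hδ⟩ := (h.nondegenerate (by omega) hF hG hr).exists_finrank_pow_succ_smul_eq
    (by omega) ((finrank_forms_one k r).trans_le hr5) fun b c =>
      exists_contract_ne (by omega) (hmem c) hG (by rwa [span_pair_add_smul]) b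
  refine ⟨F + c • G, hmem c, δ, fun i hi hie => ?_⟩
  have hi' := hδ (i - 1) (by omega)
  rw [Nat.sub_add_cancel hi, forms_one_pow, finrank_forms_one] at hi'
  rwa [hVector_apolarIdeal (by omega : i + (e - i) = e) (span_pair_le_functionals hF hG)]

theorem IsLevel.hVector_sub_eq [Infinite k] (he : 4 ≤ e) (hr5 : r ≤ 5) (h : IsLevel I e 2)
    (hr : hVector I (e - 1) = r) {i : ℕ} (hi : 1 ≤ i) (hie : i ≤ e - 1) :
    hVector I (e - i) = hVector I i := by
  obtain ⟨F, hF, δ, hδ⟩ := h.exists_gorenstein he hr5 hr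
  have hsub := (hδ (e - i) (by omega) (by omega)).1
  rw [show e - (e - i) = i by omega] at hsub
  rw [(hδ i hi hie).1, hsub, finrank_forms_smul_span_singleton_symm (by omega : i + (e - i) = e) hF]

theorem IsLevel.hVector_le_of_eq [Infinite k] (he : 4 ≤ e) (hr5 : r ≤ 5) (h : IsLevel I e 2)
    (hr : hVector I (e - 1) = r) {i : ℕ} (hi : 1 ≤ i) (hie : i ≤ e - 1) :
    hVector I (e - i) ≤ min ((r - 1).multichoose i + 1) ((r - 1).multichoose (e - i) + 1) := by
  obtain ⟨F, -, δ, hδ⟩ := h.exists_gorenstein he hr5 hr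
  refine le_min (hδ i hi hie).2 ?_
  rw [h.hVector_sub_eq he hr5 hr hi hie]
  simpa only [show e - (e - i) = i by omega] using (hδ (e - i) (by omega) (by omega)).2

end UpperBounds

/-! ### General points -/

section Semicontinuity

open Filter

variable {k M N : Type*} [Field k] [AddCommGroup M] [Module k M] [AddCommGroup N] [Module k N]

theorem eventually_injective_id_add_smul [FiniteDimensional k M] (B : Module.End k M) :
    ∀ᶠ c : k in cofinite, Function.Injective (LinearMap.id + c • B : Module.End k M) := by
  refine (B.finite_hasEigenvalue.image fun a => -a⁻¹).subset fun c hc => ?_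
  obtain ⟨v, hv, hv0⟩ : ∃ v, v + c • B v = 0 ∧ v ≠ 0 := by
    contrapose! hc
    exact fun h => h ((injective_iff_map_eq_zero _).2 hc)
  have hc0 : c ≠ 0 := by
    rintro rfl
    simp [hv0] at hv
  have hBv : B v = -c⁻¹ • v := by
    rw [← inv_smul_smul₀ hc0 (B v), eq_neg_of_add_eq_zero_right hv, smul_neg, neg_smul]
  exact ⟨-c⁻¹, Module.End.hasEigenvalue_of_hasEigenvector
    (Module.End.hasEigenvector_iff.2 ⟨Module.End.mem_eigenspace_iff.2 hBv, hv0⟩), by simp⟩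

theorem eventually_finrank_range_le [FiniteDimensional k M] (f g : M →ₗ[k] N) :
    ∀ᶠ c : k in cofinite,
      finrank k (LinearMap.range f) ≤ finrank k (LinearMap.range (f + c • g)) := by
  obtain ⟨S, hS⟩ := Submodule.exists_isCompl (LinearMap.ker f)
  have hfS : Function.Injective (f.domRestrict S) :=
    LinearMap.injective_domRestrict_iff.2 hS.symm.disjoint
  obtain ⟨h, hh⟩ := LinearMap.exists_leftInverse_of_injective _ (LinearMap.ker_eq_bot.2 hfS)
  filter_upwards [eventually_injective_id_add_smul (h ∘ₗ g.domRestrict S)] with c hc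
  have hcomp : h ∘ₗ (f + c • g).domRestrict S = LinearMap.id + c • h ∘ₗ g.domRestrict S := by
    rw [← hh, ← LinearMap.comp_smul, ← LinearMap.comp_add]
    rfl
  have hinj : Function.Injective ((f + c • g).domRestrict S) :=
    Function.Injective.of_comp (f := h) (by rwa [← LinearMap.coe_comp, hcomp])
  have hfinrank := finrank_add_eq_of_isCompl hS
  have hker := LinearMap.finrank_range_add_finrank_ker f
  calc finrank k (LinearMap.range f) = finrank k S := by omega
    _ = finrank k (S.map (f + c • g)) := by
      rw [← LinearMap.range_domRestrict, LinearMap.finrank_range_of_inj hinj]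
    _ ≤ _ := finrank_mono LinearMap.map_le_range

variable {R D : Type*} [CommRing R] [Algebra k R] [AddCommGroup D] [Module k D] [Module R D]
  [IsScalarTower k R D]

theorem eventually_finrank_sup_smul_le (N : Submodule k D) [FiniteDimensional k N]
    (S : Submodule k R) [FiniteDimensional k S] (F E : D) :
    ∀ᶠ c : k in cofinite,
      finrank k ↥(N ⊔ S • (k ∙ F)) ≤ finrank k ↥(N ⊔ S • (k ∙ (F + c • E))) := by
  have hrange (F : D) : N ⊔ S • (k ∙ F) =
      LinearMap.range (N.subtype.coprod ((orbitMap k F).domRestrict S)) := by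
    rw [LinearMap.range_coprod, range_subtype, LinearMap.range_domRestrict, smul_span_singleton]
  filter_upwards [eventually_finrank_range_le (N.subtype.coprod ((orbitMap k F).domRestrict S))
    (LinearMap.coprod 0 ((orbitMap k E).domRestrict S))] with c hc
  have hcoprod : N.subtype.coprod ((orbitMap k (F + c • E)).domRestrict S) =
      N.subtype.coprod ((orbitMap k F).domRestrict S) +
        c • LinearMap.coprod 0 ((orbitMap k E).domRestrict S) := by
    ext x <;> simp [smul_comm _ c]
  rwa [hrange, hrange, hcoprod]

end Semicontinuity

section Points

variable {k : Type*} [Field k] {r : ℕ}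

/-- Evaluation at the point `p` on forms of degree `e`, extended by zero to the other degrees.
This is the `e`-th divided power of a linear form in Macaulay's inverse system. -/
def point (e : ℕ) (p : Fin r → k) : Functional k r :=
  (aeval p : MvPolynomial (Fin r) k →ₐ[k] k).toLinearMap ∘ₗ homogeneousComponent e

theorem point_apply {e : ℕ} {p : Fin r → k} {q : MvPolynomial (Fin r) k} (hq : q ∈ forms k r e) :
    point e p q = eval p q := by
  rw [point, LinearMap.comp_apply, homogeneousComponent_of_mem hq, if_pos rfl,
    AlgHom.toLinearMap_apply, aeval_eq_eval]

theorem point_mem_functionals (e : ℕ) (p : Fin r → k) : point e p ∈ functionals k r e :=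
  comp_homogeneousComponent_mem_functionals _ e

theorem contract_point {i j e : ℕ} (hij : i + j = e) (p : Fin r → k)
    {a : MvPolynomial (Fin r) k} (ha : a ∈ forms k r i) :
    a • point e p = eval p a • point j p := by
  subst hij
  refine eq_of_mem_functionals (contract_mem_functionals rfl ha (point_mem_functionals _ p))
    (smul_mem _ _ (point_mem_functionals j p)) fun q hq => ?_
  rw [contract_apply, point_apply (IsHomogeneous.mul ha hq), map_mul, LinearMap.smul_apply,
    point_apply hq, smul_eq_mul]

theorem forms_smul_point_le {i j e : ℕ} (hij : i + j = e) (p : Fin r → k) :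
    forms k r i • (k ∙ point e p) ≤ k ∙ point j p :=
  smul_span_singleton_le.2 fun a ha =>
    mem_span_singleton.2 ⟨eval p a, (contract_point hij p ha).symm⟩

theorem sup_forms_smul_add_point_eq {i j e : ℕ} (hij : i + j = e) {N : Submodule k (Functional k r)}
    {F : Functional k r} {f : MvPolynomial (Fin r) k} (hf : f ∈ forms k r i) (hfF : f • F ∈ N)
    {p : Fin r → k} (hfp : eval p f ≠ 0) {c : k} (hc : c ≠ 0) :
    N ⊔ forms k r i • (k ∙ (F + c • point e p)) = N ⊔ forms k r i • (k ∙ F) ⊔ k ∙ point j p := by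
  have hexpand : ∀ a ∈ forms k r i,
      a • (F + c • point e p) = a • F + (c * eval p a) • point j p := fun a ha => by
    rw [smul_add, smul_comm a c, contract_point hij p ha, smul_smul]
  have hmem : ∀ a ∈ forms k r i, a • F + (c * eval p a) • point j p ∈
      N ⊔ forms k r i • (k ∙ (F + c • point e p)) := fun a ha => by
    rw [← hexpand a ha]
    exact mem_sup_right (smul_mem_smul ha (mem_span_singleton_self _))
  have hpoint : point j p ∈ N ⊔ forms k r i • (k ∙ (F + c • point e p)) := by
    have := sub_mem (hmem f hf) (mem_sup_left hfF)
    rwa [add_sub_cancel_left, smul_mem_iff _ (mul_ne_zero hc hfp)] at this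
  refine le_antisymm (sup_le (le_sup_left.trans le_sup_left) ?_)
    (sup_le (sup_le le_sup_left ?_) ((span_singleton_le_iff_mem _ _).2 hpoint))
  · refine smul_span_singleton_le.2 fun a ha => hexpand a ha ▸ add_mem ?_ ?_
    · exact mem_sup_left (mem_sup_right (smul_mem_smul ha (mem_span_singleton_self F)))
    · exact mem_sup_right (smul_mem _ _ (mem_span_singleton_self _))
  · refine smul_span_singleton_le.2 fun a ha => ?_
    have := sub_mem (hmem a ha) (smul_mem _ (c * eval p a) hpoint)
    rwa [add_sub_cancel_right] at this

theorem exists_contract_mem_of_finrank_lt {S : Submodule k (MvPolynomial (Fin r) k)}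
    [FiniteDimensional k S] {N : Submodule k (Functional k r)} [FiniteDimensional k N]
    {F : Functional k r} (h : finrank k ↥(N ⊔ S • (k ∙ F)) < finrank k N + finrank k S) :
    ∃ f ∈ S, f ≠ 0 ∧ f • F ∈ N := by
  have hrank := finrank_map_mkQ_add_finrank (S • (k ∙ F)) N
  have hker := finrank_map_add_finrank_inf_ker (N.mkQ ∘ₗ orbitMap k F) S
  rw [Submodule.map_comp, ← smul_span_singleton] at hker
  rw [sup_comm] at h
  have hne : S ⊓ LinearMap.ker (N.mkQ ∘ₗ orbitMap k F) ≠ ⊥ := fun h0 => by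
    rw [h0, finrank_bot] at hker
    omega
  obtain ⟨f, ⟨hfS, hf⟩, hf0⟩ := exists_mem_ne_zero_of_ne_bot hne
  exact ⟨f, hfS, hf0, (Submodule.Quotient.mk_eq_zero N).1 hf⟩

theorem exists_sup_smul_add_point [Infinite k] {i j e : ℕ} (hij : i + j = e)
    {N : Submodule k (Functional k r)} (hN : N ≤ functionals k r j) {F : Functional k r}
    (hF : F ∈ functionals k r e)
    (hlt : finrank k ↥(N ⊔ forms k r i • (k ∙ F)) <
      min (finrank k N + r.multichoose i) (r.multichoose j)) :
    ∃ p : Fin r → k, ∀ c : k, c ≠ 0 → finrank k ↥(N ⊔ forms k r i • (k ∙ (F + c • point e p))) =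
      finrank k ↥(N ⊔ forms k r i • (k ∙ F)) + 1 := by
  have := finiteDimensional_of_le hN
  set W := N ⊔ forms k r i • (k ∙ F) with hWdef
  have hW : W ≤ functionals k r j :=
    sup_le hN (forms_smul_le_functionals hij ((span_singleton_le_iff_mem _ _).2 hF))
  rw [lt_min_iff, ← finrank_homogeneousSubmodule k, ← finrank_homogeneousSubmodule k] at hlt
  obtain ⟨f, hf, hf0, hfF⟩ := exists_contract_mem_of_finrank_lt hlt.1
  obtain ⟨g, ⟨hg, hgW⟩, hg0⟩ : ∃ g ∈ forms k r j ⊓ W.dualCoannihilator, g ≠ 0 := by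
    refine exists_mem_ne_zero_of_ne_bot fun h0 => hlt.2.ne ?_
    rw [← finrank_add_finrank_inf_dualCoannihilator hW, h0, finrank_bot, add_zero]
  obtain ⟨p, hp⟩ : ∃ p, eval p (f * g) ≠ 0 := by
    contrapose! hf0
    exact (mul_eq_zero.1 (MvPolynomial.funext fun p => by rw [hf0 p, map_zero])).resolve_right hg0
  rw [map_mul] at hp
  have hpW : point j p ∉ W := fun h => by
    have := (mem_dualCoannihilator _).1 hgW _ h
    rw [point_apply hg] at this
    exact right_ne_zero_of_mul hp this
  refine ⟨p, fun c hc => ?_⟩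
  rw [sup_forms_smul_add_point_eq hij hf hfF (left_ne_zero_of_mul hp) hc]
  have := finiteDimensional_of_le hW
  exact finrank_sup_span_singleton_of_notMem hpW

theorem exists_finrank_sup_smul_succ [Infinite k] {e : ℕ} {N : ℕ → Submodule k (Functional k r)}
    (hN : ∀ i ≤ e, N i ≤ functionals k r (e - i)) {F : Functional k r} (hF : F ∈ functionals k r e)
    {i : ℕ} (hi : i ≤ e) (hlt : finrank k ↥(N i ⊔ forms k r i • (k ∙ F)) <
      min (finrank k (N i) + r.multichoose i) (r.multichoose (e - i))) :
    ∃ E ∈ functionals k r e, finrank k ↥(N i ⊔ forms k r i • (k ∙ E)) =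
        finrank k ↥(N i ⊔ forms k r i • (k ∙ F)) + 1 ∧
      ∀ l ≤ e, finrank k ↥(N l ⊔ forms k r l • (k ∙ F)) ≤
        finrank k ↥(N l ⊔ forms k r l • (k ∙ E)) := by
  obtain ⟨p, hp⟩ := exists_sup_smul_add_point (by omega : i + (e - i) = e) (hN i hi) hF hlt
  have hgeneric : ∀ᶠ c : k in Filter.cofinite, ∀ l ∈ Finset.range (e + 1),
      finrank k ↥(N l ⊔ forms k r l • (k ∙ F)) ≤
        finrank k ↥(N l ⊔ forms k r l • (k ∙ (F + c • point e p))) := by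
    refine (Filter.eventually_all_finset _).2 fun l hl => ?_
    have := finiteDimensional_of_le (hN l (Finset.mem_range_succ_iff.1 hl))
    exact eventually_finrank_sup_smul_le ..
  obtain ⟨c, hc0, hc⟩ := ((Filter.eventually_cofinite_ne 0).and hgeneric).exists
  exact ⟨F + c • point e p, add_mem hF (smul_mem _ _ (point_mem_functionals e p)), hp c hc0,
    fun l hl => hc l (Finset.mem_range_succ_iff.2 hl)⟩

theorem exists_finrank_sup_smul_eq [Infinite k] {e : ℕ} {N : ℕ → Submodule k (Functional k r)}
    (hN : ∀ i ≤ e, N i ≤ functionals k r (e - i)) {F : Functional k r} (hF : F ∈ functionals k r e)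
    {i v : ℕ} (hi : i ≤ e) (hFv : finrank k ↥(N i ⊔ forms k r i • (k ∙ F)) ≤ v)
    (hv : v ≤ min (finrank k (N i) + r.multichoose i) (r.multichoose (e - i))) :
    ∃ E ∈ functionals k r e, finrank k ↥(N i ⊔ forms k r i • (k ∙ E)) = v ∧
      ∀ l ≤ e, finrank k ↥(N l ⊔ forms k r l • (k ∙ F)) ≤
        finrank k ↥(N l ⊔ forms k r l • (k ∙ E)) := by
  induction v, hFv using Nat.le_induction with
  | base => exact ⟨F, hF, rfl, fun _ _ => le_rfl⟩
  | succ v _ ih =>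
    obtain ⟨E, hE, hEv, hFE⟩ := ih (by omega)
    obtain ⟨E', hE', hEv', hEE'⟩ := exists_finrank_sup_smul_succ hN hE hi (by omega)
    exact ⟨E', hE', hEv'.trans (by rw [hEv]), fun l hl => (hFE l hl).trans (hEE' l hl)⟩

theorem exists_forall_le_finrank_sup_smul [Infinite k] {e : ℕ}
    {N : ℕ → Submodule k (Functional k r)} (hN : ∀ i ≤ e, N i ≤ functionals k r (e - i)) :
    ∃ F ∈ functionals k r e, ∀ i ≤ e, min (finrank k (N i) + r.multichoose i)
      (r.multichoose (e - i)) ≤ finrank k ↥(N i ⊔ forms k r i • (k ∙ F)) := by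
  suffices ∀ n ≤ e + 1, ∃ F ∈ functionals k r e, ∀ i < n, min (finrank k (N i) + r.multichoose i)
      (r.multichoose (e - i)) ≤ finrank k ↥(N i ⊔ forms k r i • (k ∙ F)) by
    simpa only [Nat.lt_succ_iff] using this (e + 1) le_rfl
  intro n hn
  induction n with
  | zero => exact ⟨0, zero_mem _, by simp⟩
  | succ n ih =>
    obtain ⟨F, hF, hFn⟩ := ih (by omega)
    obtain hle | hlt := le_or_gt (min (finrank k (N n) + r.multichoose n) (r.multichoose (e - n)))
      (finrank k ↥(N n ⊔ forms k r n • (k ∙ F)))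
    · exact ⟨F, hF, Nat.forall_lt_succ_right.2 ⟨hFn, hle⟩⟩
    · obtain ⟨E, hE, hEn, hFE⟩ := exists_finrank_sup_smul_eq hN hF (by omega) hlt.le le_rfl
      exact ⟨E, hE, Nat.forall_lt_succ_right.2
        ⟨fun i hi => (hFn i hi).trans (hFE i (by omega)), hEn.ge⟩⟩

theorem exists_sum_points [Infinite k] {i j e n : ℕ} (hij : i + j = e)
    {N : Submodule k (Functional k r)} (hN : N ≤ functionals k r j) (hi : n ≤ r.multichoose i)
    (hj : finrank k N + n ≤ r.multichoose j) :
    ∃ F ∈ functionals k r e, finrank k ↥(N ⊔ forms k r i • (k ∙ F)) = finrank k N + n ∧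
      ∀ l ≤ e, finrank k ↥(forms k r l • (k ∙ F)) ≤ n := by
  induction n with
  | zero =>
    refine ⟨0, zero_mem _, ?_, fun l _ => ?_⟩
    · rw [span_zero_singleton, Submodule.smul_bot, sup_bot_eq, add_zero]
    · rw [span_zero_singleton, Submodule.smul_bot, finrank_bot]
  | succ n ih =>
    obtain ⟨F, hF, hFn, hFl⟩ := ih (by omega) (by omega)
    obtain ⟨p, hp⟩ := exists_sup_smul_add_point hij hN hF (by omega)
    refine ⟨F + (1 : k) • point e p, add_mem hF (smul_mem _ _ (point_mem_functionals e p)),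
      by rw [hp 1 one_ne_zero, hFn, add_assoc], fun l hl => ?_⟩
    calc finrank k ↥(forms k r l • (k ∙ (F + (1 : k) • point e p)))
      _ ≤ finrank k ↥(forms k r l • (k ∙ F) ⊔ k ∙ point (e - l) p) := by
        refine finrank_mono ((smul_span_singleton_add_le _ F (point e p) 1).trans ?_)
        rw [smul_span_pair]
        exact sup_le_sup_left (forms_smul_point_le (by omega) p) _
      _ ≤ n + 1 := (finrank_sup_span_singleton_le _ _).trans (Nat.add_le_add_right (hFl l hl) 1)

theorem exists_finrank_eq_and_finrank_one [Infinite k] {e : ℕ}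
    {N : ℕ → Submodule k (Functional k r)} (hN : ∀ i ≤ e, N i ≤ functionals k r (e - i))
    (hN1 : finrank k (N 1) + r ≤ r.multichoose (e - 1)) {i v : ℕ} (he : 1 ≤ e) (hi : i ≤ e)
    (hNv : finrank k (N i) + r ≤ v)
    (hv : v ≤ min (finrank k (N i) + r.multichoose i) (r.multichoose (e - i))) :
    ∃ F ∈ functionals k r e, finrank k ↥(N i ⊔ forms k r i • (k ∙ F)) = v ∧
      finrank k (N 1) + r ≤ finrank k ↥(N 1 ⊔ forms k r 1 • (k ∙ F)) := by
  obtain ⟨F, hF, hF1, hFl⟩ := exists_sum_points (by omega : 1 + (e - 1) = e) (hN 1 he)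
    (Nat.multichoose_one_right r).ge hN1
  have := finiteDimensional_of_le (hN i hi)
  have hFv : finrank k ↥(N i ⊔ forms k r i • (k ∙ F)) ≤ v :=
    (finrank_add_le_finrank_add_finrank _ _).trans ((Nat.add_le_add_left (hFl i hi) _).trans hNv)
  obtain ⟨E, hE, hEv, hFE⟩ := exists_finrank_sup_smul_eq hN hF hi hFv hv
  exact ⟨E, hE, hEv, hF1.ge.trans (hFE 1 he)⟩

end Points

section Pull

variable {k : Type*} [Field k] {r b : ℕ} {f : Fin b → Fin r} (hf : Function.Injective f)

theorem killCompl_mem_forms {d : ℕ} {p : MvPolynomial (Fin r) k} (hp : p ∈ forms k r d) :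
    killCompl hf p ∈ forms k b d := by
  have hone : (forms k r 1).map (killCompl hf).toLinearMap ≤ forms k b 1 := by
    rw [forms, homogeneousSubmodule_one_eq_span_X, Submodule.map_span, span_le]
    rintro _ ⟨_, ⟨j, rfl⟩, rfl⟩
    rw [AlgHom.toLinearMap_apply, killCompl, aeval_X]
    split_ifs
    · exact isHomogeneous_X k _
    · exact zero_mem _
  have hpow := pow_le_pow_left' hone d
  rw [← Submodule.map_pow, forms_one_pow, forms_one_pow] at hpow
  exact hpow ⟨p, hp, rfl⟩

theorem exists_killCompl_eq {d : ℕ} {q : MvPolynomial (Fin b) k} (hq : q ∈ forms k b d) :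
    ∃ p ∈ forms k r d, killCompl hf p = q :=
  ⟨rename f q, IsHomogeneous.rename_isHomogeneous hq, killCompl_rename_app hf q⟩

/-- The functionals in the variables indexed by `Fin b`, viewed as functionals in the variables
indexed by `Fin r` through an injection. -/
def pull : Functional k b →ₗ[k] Functional k r :=
  (killCompl hf).toLinearMap.dualMap

theorem pull_apply (φ : Functional k b) (p : MvPolynomial (Fin r) k) :
    pull hf φ p = φ (killCompl hf p) := rfl

theorem pull_mem_functionals {e : ℕ} {φ : Functional k b} (hφ : φ ∈ functionals k b e) :
    pull hf φ ∈ functionals k r e :=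
  mem_functionals.2 fun d hd _ hq => mem_functionals.1 hφ d hd _ (killCompl_mem_forms hf hq)

theorem contract_pull (p : MvPolynomial (Fin r) k) (φ : Functional k b) :
    p • pull hf φ = pull hf (killCompl hf p • φ) := LinearMap.ext fun q => by
  rw [contract_apply, pull_apply, pull_apply, map_mul, contract_apply]

theorem pull_injective : Function.Injective (pull hf : Functional k b →ₗ[k] Functional k r) :=
  LinearMap.dualMap_injective_of_surjective fun q => ⟨rename f q, killCompl_rename_app hf q⟩

theorem forms_smul_pull (i : ℕ) (φ : Functional k b) :
    forms k r i • (k ∙ pull hf φ) = (forms k b i • (k ∙ φ)).map (pull hf) := by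
  refine le_antisymm (smul_span_singleton_le.2 fun p hp => ?_) ?_
  · rw [contract_pull]
    exact mem_map_of_mem (smul_mem_smul (killCompl_mem_forms hf hp) (mem_span_singleton_self φ))
  · refine map_le_iff_le_comap.2 (smul_span_singleton_le.2 fun q hq => ?_)
    obtain ⟨p, hp, rfl⟩ := exists_killCompl_eq hf hq
    rw [mem_comap, ← contract_pull]
    exact smul_mem_smul hp (mem_span_singleton_self _)

theorem finrank_forms_smul_pull (i : ℕ) (φ : Functional k b) :
    finrank k ↥(forms k r i • (k ∙ pull hf φ)) = finrank k ↥(forms k b i • (k ∙ φ)) := by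
  rw [forms_smul_pull]
  exact (equivMapOfInjective _ (pull_injective hf) _).finrank_eq.symm

end Pull

/-! ### Existence -/

section Multichoose

theorem multichoose_mono_right {n : ℕ} (hn : 1 ≤ n) {i j : ℕ} (h : i ≤ j) :
    n.multichoose i ≤ n.multichoose j := by
  obtain ⟨n, rfl⟩ := Nat.exists_eq_add_of_le' hn
  refine monotone_nat_of_le_succ (f := (n + 1).multichoose) (fun i => ?_) h
  rw [Nat.multichoose_succ_succ]
  exact Nat.le_add_left _ _

theorem le_multichoose {n i : ℕ} (hi : 1 ≤ i) : n ≤ n.multichoose i := by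
  obtain rfl | hn := n.eq_zero_or_pos
  · exact Nat.zero_le _
  · exact (Nat.multichoose_one_right n).ge.trans (multichoose_mono_right hn hi)

theorem two_mul_le_multichoose {n i : ℕ} (hn : 2 ≤ n) (hi : 3 ≤ i) :
    2 * n ≤ n.multichoose i := by
  refine le_trans ?_ (multichoose_mono_right (by omega) hi)
  induction n, hn using Nat.le_induction with
  | base => rw [Nat.multichoose_two]
  | succ n _ ih =>
    have hle : n + 1 ≤ (n + 1).multichoose 2 := le_multichoose one_le_two
    have hsucc : (n + 1).multichoose 3 = n.multichoose 3 + (n + 1).multichoose 2 :=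
      Nat.multichoose_succ_succ n 2
    omega

theorem choose_eq_multichoose {n : ℕ} (hn : 1 ≤ n) (i : ℕ) :
    (n - 1 + i).choose i = n.multichoose i := by
  rw [Nat.multichoose_eq, Nat.sub_add_comm hn]

end Multichoose

section InitialEntries

variable {k : Type*} [Field k] {r e t : ℕ} {I : Ideal (MvPolynomial (Fin r) k)}

theorem IsLevel.hVector_zero (h : IsLevel I e t) : hVector I 0 = 1 := by
  have hle := hVector_le I 0
  rw [Nat.multichoose_zero_right] at hle
  have hne : hVector I 0 ≠ 0 := fun h0 => h.top_ne_zero <| by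
    rw [I.eq_top_of_isUnit_mem (hVector_eq_zero_iff.1 h0 1 (isHomogeneous_one _ _)) isUnit_one]
    exact hVector_eq_zero_iff.2 fun _ _ => mem_top
  omega

theorem hVector_one_eq_iff : hVector I 1 = r ↔ ∀ x ∈ forms k r 1, x ∈ I → x = 0 := by
  have hadd := hVector_add_finrank I 1
  rw [finrank_forms_one] at hadd
  have : FiniteDimensional k (forms k r 1 ⊓ I.restrictScalars k : Submodule k _) :=
    finiteDimensional_of_le inf_le_left
  have hbot : hVector I 1 = r ↔ (forms k r 1 ⊓ I.restrictScalars k : Submodule k _) = ⊥ := by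
    rw [← Submodule.finrank_eq_zero]
    omega
  rw [hbot, Submodule.eq_bot_iff]
  exact ⟨fun h x hx hxI => h x ⟨hx, hxI⟩, fun h x hx => h x hx.1 hx.2⟩

theorem IsLevel.hVector_one (h : IsLevel I e t) : hVector I 1 = r :=
  hVector_one_eq_iff.2 fun x hx hxI => h.no_linear_form x hxI hx

end InitialEntries

section Existence

variable {k : Type*} [Field k] {r e : ℕ}

theorem finrank_forms_smul_span_singleton_le (i : ℕ) (F : Functional k r) :
    finrank k ↥(forms k r i • (k ∙ F)) ≤ r.multichoose i := by
  rw [smul_span_singleton, ← finrank_homogeneousSubmodule k]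
  exact finrank_map_le _ _

theorem finrank_forms_one_smul_le (F : Functional k r) :
    finrank k ↥(forms k r 1 • (k ∙ F)) ≤ r :=
  (finrank_forms_smul_span_singleton_le 1 F).trans_eq (Nat.multichoose_one_right r)

theorem finrank_forms_one_smul_pull_le {b : ℕ} {f : Fin b → Fin r} (hf : Function.Injective f)
    (F : Functional k b) : finrank k ↥(forms k r 1 • (k ∙ pull hf F)) ≤ b :=
  (finrank_forms_smul_pull hf 1 F).trans_le (finrank_forms_one_smul_le F)

theorem eq_zero_of_contract_eq_zero {F : Functional k r}
    (h : r ≤ finrank k ↥(forms k r 1 • (k ∙ F))) {x : MvPolynomial (Fin r) k}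
    (hx : x ∈ forms k r 1) (hxF : x • F = 0) : x = 0 := by
  have hrank := finrank_map_add_finrank_inf_ker (orbitMap k F) (forms k r 1)
  have : FiniteDimensional k ↥(forms k r 1 ⊓ LinearMap.ker (orbitMap k F)) :=
    finiteDimensional_of_le inf_le_left
  rw [← smul_span_singleton, finrank_forms_one] at hrank
  have hker : forms k r 1 ⊓ LinearMap.ker (orbitMap k F) = ⊥ :=
    Submodule.finrank_eq_zero.1 (by omega)
  exact (Submodule.eq_bot_iff _).1 hker x ⟨hx, hxF⟩

theorem ne_zero_of_finrank_smul_pos {S : Submodule k (MvPolynomial (Fin r) k)} {F : Functional k r}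
    (h : 0 < finrank k ↥(S • (k ∙ F))) : F ≠ 0 := by
  rintro rfl
  rw [span_zero_singleton, Submodule.smul_bot, finrank_bot] at h
  exact h.false

theorem exists_finrank_smul_eq [Infinite k] {i v : ℕ} (hi : 1 ≤ i) (hie : i ≤ e - 1) (hrv : r ≤ v)
    (hv : v ≤ min (r.multichoose i) (r.multichoose (e - i))) :
    ∃ F ∈ functionals k r e, finrank k ↥(forms k r i • (k ∙ F)) = v ∧
      r ≤ finrank k ↥(forms k r 1 • (k ∙ F)) := by
  have hr : r ≤ r.multichoose (e - 1) := le_multichoose (by omega)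
  obtain ⟨F, hF, hFv, hF1⟩ := exists_finrank_eq_and_finrank_one (k := k) (r := r) (e := e)
    (N := fun _ => ⊥) (fun _ _ => bot_le) (i := i) (v := v) (by rwa [finrank_bot, zero_add])
    (by omega) (by omega) (by rwa [finrank_bot, zero_add]) (by rwa [finrank_bot, zero_add])
  rw [bot_sup_eq] at hFv
  rw [finrank_bot, zero_add, bot_sup_eq] at hF1
  exact ⟨F, hF, hFv, hF1⟩

theorem exists_forall_le_finrank_smul (k : Type*) [Field k] [Infinite k] (r e : ℕ) :
    ∃ F ∈ functionals k r e, ∀ i ≤ e,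
      min (r.multichoose i) (r.multichoose (e - i)) ≤ finrank k ↥(forms k r i • (k ∙ F)) := by
  obtain ⟨F, hF, hFi⟩ := exists_forall_le_finrank_sup_smul (k := k) (r := r) (e := e)
    (N := fun _ => ⊥) fun _ _ => bot_le
  refine ⟨F, hF, fun i hi => ?_⟩
  have hFi := hFi i hi
  rwa [finrank_bot, zero_add, bot_sup_eq] at hFi

theorem isLevel_span_pair {F G : Functional k r} {b : ℕ} (he : 1 ≤ e)
    (hF : F ∈ functionals k r e) (hG : G ∈ functionals k r e) (hr : 1 ≤ r) (hb : 1 ≤ b)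
    (hGb : finrank k ↥(forms k r 1 • (k ∙ G)) ≤ b)
    (h : b + r ≤ finrank k ↥(forms k r 1 • (k ∙ G) ⊔ forms k r 1 • (k ∙ F))) :
    IsLevel (apolarIdeal (span k {G, F})) e 2 ∧
      hVector (apolarIdeal (span k {G, F})) (e - 1) = b + r := by
  have hW := span_pair_le_functionals hG hF
  have hFr := finrank_forms_one_smul_le F
  have hadd := finrank_add_le_finrank_add_finrank (forms k r 1 • (k ∙ G)) (forms k r 1 • (k ∙ F))
  have hF0 : F ≠ 0 := ne_zero_of_finrank_smul_pos (S := forms k r 1) (by omega)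
  have hGF : G ∉ k ∙ F := fun hmem => by
    rw [sup_of_le_right (smul_mono_right _ ((span_singleton_le_iff_mem _ _).2 hmem))] at h
    omega
  have htwo : finrank k (span k {G, F}) = 2 := by
    rw [Set.pair_comm, finrank_span_pair hF0 hGF]
  have hlevel := isLevel_apolarIdeal hW (ne_bot_of_le_ne_bot
    (span_singleton_eq_bot.not.2 hF0) (span_mono (by simp))) fun x hx hxW =>
      eq_zero_of_contract_eq_zero (by omega) hx (mem_apolarIdeal_span_pair.1 hxW).2
  rw [htwo] at hlevel
  refine ⟨hlevel, ?_⟩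
  rw [hVector_apolarIdeal (by omega : 1 + (e - 1) = e) hW, smul_span_pair]
  omega

theorem hVector_apolarIdeal_span_pair {F G : Functional k r} {i : ℕ} (hi : i ≤ e)
    (hF : F ∈ functionals k r e) (hG : G ∈ functionals k r e) :
    hVector (apolarIdeal (span k {F, G})) (e - i) =
      finrank k ↥(forms k r i • (k ∙ F) ⊔ forms k r i • (k ∙ G)) := by
  rw [hVector_apolarIdeal (by omega : i + (e - i) = e) (span_pair_le_functionals hF hG),
    smul_span_pair]

theorem exists_isLevel_of_lt [Infinite k] {b i v : ℕ} (hr : 2 ≤ r) (he : 4 ≤ e) (hb : 1 ≤ b)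
    (hbr : b ≤ r) (hi : 1 ≤ i) (hie : i ≤ e - 1) (hbv : b + r ≤ v)
    (hv : v ≤ min (r.multichoose i + b.multichoose i) (r.multichoose (e - i))) :
    ∃ I : Ideal (MvPolynomial (Fin r) k), IsLevel I e 2 ∧ hVector I (e - 1) = b + r ∧
      hVector I (e - i) = v := by
  set w := min (v - r) (min (b.multichoose i) (b.multichoose (e - i)))
  have hbi : b ≤ b.multichoose i := le_multichoose hi
  have hbi' : b ≤ b.multichoose (e - i) := le_multichoose (by omega)
  have hri : r ≤ r.multichoose i := le_multichoose hi
  have h2r : 2 * r ≤ r.multichoose (e - 1) := two_mul_le_multichoose hr (by omega)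
  obtain ⟨G, hG, hGw, hG1⟩ := exists_finrank_smul_eq (k := k) (r := b) (v := w) hi hie
    (by omega) (by omega)
  have hf := Fin.castLE_injective hbr
  have hG' := pull_mem_functionals hf hG
  rw [← finrank_forms_smul_pull hf] at hG1 hGw
  have hGb := finrank_forms_one_smul_pull_le hf G
  have hvw : v ≤ w + r.multichoose i := by
    rcases le_total i (e - i) with hle | hle
    · have := multichoose_mono_right hb hle
      omega
    · have := multichoose_mono_right (by omega : 1 ≤ r) hle
      omega
  obtain ⟨F, hF, hFv, hF1⟩ := exists_finrank_eq_and_finrank_one (e := e)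
    (N := fun l => forms k r l • (k ∙ pull hf G)) (i := i) (v := v)
    (fun l hl => forms_smul_le_functionals (by omega) ((span_singleton_le_iff_mem _ _).2 hG'))
    (by omega) (by omega) (by omega) (by omega) (by omega)
  obtain ⟨hlevel, htop⟩ := isLevel_span_pair (by omega) hF hG' (by omega) hb hGb (by omega)
  exact ⟨_, hlevel, htop, (hVector_apolarIdeal_span_pair (by omega) hG' hF).trans hFv⟩

theorem exists_isLevel_max_of_lt [Infinite k] {b : ℕ} (hr : 2 ≤ r) (he : 4 ≤ e) (hb : 1 ≤ b)
    (hbr : b ≤ r) :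
    ∃ I : Ideal (MvPolynomial (Fin r) k), IsLevel I e 2 ∧ hVector I (e - 1) = b + r ∧
      ∀ i ≤ e, min (r.multichoose i + b.multichoose i) (r.multichoose (e - i)) ≤
        hVector I (e - i) := by
  have hf := Fin.castLE_injective hbr
  obtain ⟨G, hG, hGi⟩ := exists_forall_le_finrank_smul k b e
  have hG' := pull_mem_functionals hf hG
  obtain ⟨F, hF, hFi⟩ := exists_forall_le_finrank_sup_smul (e := e)
    (N := fun i => forms k r i • (k ∙ pull hf G)) fun i hi =>
      forms_smul_le_functionals (by omega) ((span_singleton_le_iff_mem _ _).2 hG')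
  have hmax : ∀ i ≤ e, min (r.multichoose i + b.multichoose i) (r.multichoose (e - i)) ≤
      finrank k ↥(forms k r i • (k ∙ pull hf G) ⊔ forms k r i • (k ∙ F)) := fun i hi => by
    have hGi := (hGi i hi).trans_eq (finrank_forms_smul_pull hf i G).symm
    have hFi := hFi i hi
    rcases le_total i (e - i) with hle | hle
    · have := multichoose_mono_right hb hle
      omega
    · have := multichoose_mono_right (by omega : 1 ≤ r) hle
      omega
  have h2r : 2 * r ≤ r.multichoose (e - 1) := two_mul_le_multichoose hr (by omega)
  have hmax1 := hmax 1 (by omega)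
  rw [Nat.multichoose_one_right, Nat.multichoose_one_right] at hmax1
  have hGb := finrank_forms_one_smul_pull_le hf G
  obtain ⟨hlevel, htop⟩ := isLevel_span_pair (by omega) hF hG' (by omega) hb hGb (by omega)
  exact ⟨_, hlevel, htop, fun i hi =>
    (hmax i hi).trans_eq (hVector_apolarIdeal_span_pair hi hG' hF).symm⟩

/-- The evaluation of forms of degree `e` at the last coordinate point. -/
def lastPoint (k : Type*) [Field k] (n e : ℕ) : Functional k (n + 1) :=
  point e (Pi.single (Fin.last n) 1)

theorem lastPoint_mem_functionals (n e : ℕ) : lastPoint k n e ∈ functionals k (n + 1) e :=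
  point_mem_functionals e _

theorem lastPoint_apply_X_pow (n d : ℕ) : lastPoint k n d (X (Fin.last n) ^ d) = 1 := by
  rw [lastPoint, point_apply (isHomogeneous_X_pow _ d), map_pow, eval_X, Pi.single_eq_same,
    one_pow]

theorem forms_smul_lastPoint {i j n : ℕ} (hij : i + j = e) :
    forms k (n + 1) i • (k ∙ lastPoint k n e) = k ∙ lastPoint k n j := by
  refine le_antisymm (forms_smul_point_le hij _) ((span_singleton_le_iff_mem _ _).2 ?_)
  have hX := isHomogeneous_X_pow (R := k) (Fin.last n) i
  have hmem := smul_mem_smul (show _ ∈ forms k (n + 1) i from hX)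
    (mem_span_singleton_self (R := k) (lastPoint k n e))
  rwa [lastPoint, contract_point hij _ hX, map_pow, eval_X, Pi.single_eq_same, one_pow,
    one_smul] at hmem

theorem lastPoint_notMem_map_pull {n d : ℕ} (hd : d ≠ 0) (N : Submodule k (Functional k n)) :
    lastPoint k n d ∉ N.map (pull (Fin.castSucc_injective n)) := by
  rintro ⟨φ, -, hφ⟩
  have hX : killCompl (Fin.castSucc_injective n) (X (Fin.last n) : MvPolynomial _ k) = 0 := by
    rw [killCompl, aeval_X, dif_neg]
    rintro ⟨i, hi⟩
    exact i.castSucc_ne_last hi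
  have happly := LinearMap.congr_fun hφ (X (Fin.last n) ^ d)
  rw [lastPoint_apply_X_pow, pull_apply, map_pow, hX, zero_pow hd, map_zero] at happly
  exact zero_ne_one happly

theorem hVector_pull_lastPoint {n i : ℕ} (hi : i < e) {F : Functional k n}
    (hF : F ∈ functionals k n e) :
    hVector (apolarIdeal (span k {pull (Fin.castSucc_injective n) F, lastPoint k n e})) (e - i) =
      finrank k ↥(forms k n i • (k ∙ F)) + 1 := by
  have hF' := pull_mem_functionals (Fin.castSucc_injective n) hF
  have : FiniteDimensional k ↥(forms k (n + 1) i • (k ∙ pull (Fin.castSucc_injective n) F)) :=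
    finiteDimensional_of_le (forms_smul_le_functionals (by omega : i + (e - i) = e)
      ((span_singleton_le_iff_mem _ _).2 hF'))
  rw [hVector_apolarIdeal_span_pair hi.le hF' (lastPoint_mem_functionals n e),
    forms_smul_lastPoint (by omega : i + (e - i) = e), finrank_sup_span_singleton_of_notMem,
    finrank_forms_smul_pull]
  rw [forms_smul_pull]
  exact lastPoint_notMem_map_pull (by omega) _

theorem isLevel_pull_lastPoint {n : ℕ} (hn : 1 ≤ n) (he : 2 ≤ e) {F : Functional k n}
    (hF : F ∈ functionals k n e) (h : n ≤ finrank k ↥(forms k n 1 • (k ∙ F))) :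
    IsLevel (apolarIdeal (span k {pull (Fin.castSucc_injective n) F, lastPoint k n e})) e 2 := by
  have hW := span_pair_le_functionals (pull_mem_functionals (Fin.castSucc_injective n) hF)
    (lastPoint_mem_functionals n e)
  set W := span k {pull (Fin.castSucc_injective n) F, lastPoint k n e} with hWdef
  have htwo : finrank k W = 2 := by
    have hF0 := (map_ne_zero_iff (pull (Fin.castSucc_injective n)) (pull_injective _)).2
      (ne_zero_of_finrank_smul_pos (hn.trans h))
    refine finrank_span_pair hF0 ?_
    rw [← Set.image_singleton, ← Submodule.map_span]
    exact lastPoint_notMem_map_pull (by omega) _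
  have hone : hVector (apolarIdeal W) 1 = n + 1 := by
    have hle := finrank_forms_one_smul_le F
    have hval := hVector_pull_lastPoint (by omega : e - 1 < e) hF
    rw [finrank_forms_smul_span_singleton_symm (by omega : e - 1 + 1 = e) hF, ← hWdef,
      show e - (e - 1) = 1 by omega] at hval
    omega
  have hlevel := isLevel_apolarIdeal hW (fun h0 => by rw [h0, finrank_bot] at htwo; omega)
    (hVector_one_eq_iff.1 hone)
  rwa [htwo] at hlevel

theorem exists_isLevel_of_eq [Infinite k] {n i v : ℕ} (hn : 1 ≤ n) (he : 2 ≤ e) (hi : 1 ≤ i)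
    (hie : i ≤ e - 1) (hv : n + 1 ≤ v)
    (hv' : v ≤ min (n.multichoose i + 1) (n.multichoose (e - i) + 1)) :
    ∃ I : Ideal (MvPolynomial (Fin (n + 1)) k), IsLevel I e 2 ∧ hVector I (e - 1) = n + 1 ∧
      hVector I (e - i) = v := by
  obtain ⟨F, hF, hFv, hF1⟩ := exists_finrank_smul_eq (k := k) (r := n) (v := v - 1) hi hie
    (by omega) (by omega)
  refine ⟨_, isLevel_pull_lastPoint hn he hF hF1, ?_, ?_⟩
  · rw [hVector_pull_lastPoint (by omega) hF, (finrank_forms_one_smul_le F).antisymm hF1]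
  · rw [hVector_pull_lastPoint (by omega) hF, hFv]
    omega

theorem exists_isLevel_max_of_eq [Infinite k] {n : ℕ} (hn : 1 ≤ n) (he : 2 ≤ e) :
    ∃ I : Ideal (MvPolynomial (Fin (n + 1)) k), IsLevel I e 2 ∧ hVector I (e - 1) = n + 1 ∧
      ∀ i < e, hVector I (e - i) = min (n.multichoose i + 1) (n.multichoose (e - i) + 1) := by
  obtain ⟨F, hF, hFi⟩ := exists_forall_le_finrank_smul k n e
  have hmax : ∀ i ≤ e, finrank k ↥(forms k n i • (k ∙ F)) =
      min (n.multichoose i) (n.multichoose (e - i)) := fun i hi => by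
    refine le_antisymm (le_min (finrank_forms_smul_span_singleton_le i F) ?_) (hFi i hi)
    rw [finrank_forms_smul_span_singleton_symm (by omega : i + (e - i) = e) hF]
    exact finrank_forms_smul_span_singleton_le (e - i) F
  have hmax1 := hmax 1 (by omega)
  rw [Nat.multichoose_one_right, min_eq_left (le_multichoose (by omega))] at hmax1
  refine ⟨_, isLevel_pull_lastPoint hn he hF hmax1.ge, ?_, fun i hi => ?_⟩
  · rw [hVector_pull_lastPoint (by omega) hF, hmax1]
  · rw [hVector_pull_lastPoint hi hF, hmax i hi.le, min_add_add_right]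

end Existence

section MaxHVector

variable {k : Type*} [Field k] {r a e : ℕ}

theorem entryBound_self (hr : 2 ≤ r) (e i : ℕ) : entryBound r r e i =
    min ((r - 1).multichoose i + 1) ((r - 1).multichoose (e - i) + 1) := by
  have hr' : 1 ≤ r - 1 := by omega
  rw [entryBound, if_pos rfl, ← choose_eq_multichoose hr', ← choose_eq_multichoose hr', Nat.sub_sub]

theorem entryBound_of_lt (hr : 1 ≤ r) (ha : r < a) (e i : ℕ) : entryBound r a e i =
    min (r.multichoose i + (a - r).multichoose i) (r.multichoose (e - i)) := by
  rw [entryBound, if_neg ha.ne', choose_eq_multichoose hr, choose_eq_multichoose hr,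
    choose_eq_multichoose (by omega)]

theorem maxHVector_sub {i : ℕ} (hi : 2 ≤ i) (hie : i ≤ e - 2) :
    maxHVector r a e (e - i) = entryBound r a e i := by
  rw [maxHVector, if_neg (by omega), if_neg (by omega), if_pos (by omega),
    show e - (e - i) = i by omega]

theorem IsLevel.hVector_eq_maxHVector {I : Ideal (MvPolynomial (Fin r) k)} (h : IsLevel I e 2)
    (ha : hVector I (e - 1) = a) {j : ℕ} (hj : j < 2 ∨ e < j + 2) :
    hVector I j = maxHVector r a e j := by
  unfold maxHVector
  split_ifs with h0 h1 h2 h3 h4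
  · rw [h0, h.hVector_zero]
  · rw [h1, h.hVector_one]
  · omega
  · rw [← ha, ← h3, Nat.add_sub_cancel]
  · rw [h4, h.hVector_top]
  · exact h.eq_zero_above j (by omega)

theorem IsLevel.hVector_le_entryBound [Infinite k] {I : Ideal (MvPolynomial (Fin r) k)}
    (hr : 2 ≤ r) (he : 4 ≤ e) (h : IsLevel I e 2) (ha : hVector I (e - 1) = a) (hra : r ≤ a)
    (hr5 : a = r → r ≤ 5) {i : ℕ} (hi : 1 ≤ i) (hie : i ≤ e - 1) :
    hVector I (e - i) ≤ entryBound r a e i := by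
  obtain rfl | hlt := hra.eq_or_lt
  · exact (h.hVector_le_of_eq he (hr5 rfl) ha hi hie).trans_eq (entryBound_self hr e i).symm
  · subst ha
    exact (h.hVector_le_of_lt hra hi (by omega)).trans_eq
      (entryBound_of_lt (by omega) hlt e i).symm

theorem exists_isLevel_hVector_eq [Infinite k] (hr : 2 ≤ r) (he : 4 ≤ e) (hra : r ≤ a)
    (ha : a ≤ 2 * r) {i v : ℕ} (hi : 1 ≤ i) (hie : i ≤ e - 1) (hav : a ≤ v)
    (hv : v ≤ entryBound r a e i) :
    ∃ I : Ideal (MvPolynomial (Fin r) k), IsLevel I e 2 ∧ hVector I (e - 1) = a ∧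
      hVector I (e - i) = v := by
  obtain rfl | hlt := hra.eq_or_lt
  · obtain ⟨n, rfl⟩ := Nat.exists_eq_add_of_le' (one_le_two.trans hr)
    rw [entryBound_self hr] at hv
    exact exists_isLevel_of_eq (by omega) (by omega) hi hie hav hv
  · obtain ⟨b, rfl⟩ := Nat.exists_eq_add_of_le' hra
    rw [entryBound_of_lt (by omega) hlt, Nat.add_sub_cancel] at hv
    exact exists_isLevel_of_lt hr he (by omega) (by omega) hi hie hav hv

theorem exists_isLevel_entryBound_le [Infinite k] (hr : 2 ≤ r) (he : 4 ≤ e) (hra : r ≤ a)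
    (ha : a ≤ 2 * r) :
    ∃ I : Ideal (MvPolynomial (Fin r) k), IsLevel I e 2 ∧ hVector I (e - 1) = a ∧
      ∀ i < e, entryBound r a e i ≤ hVector I (e - i) := by
  obtain rfl | hlt := hra.eq_or_lt
  · obtain ⟨n, rfl⟩ := Nat.exists_eq_add_of_le' (one_le_two.trans hr)
    simp only [entryBound_self hr]
    obtain ⟨I, hI, hIe, hIi⟩ := exists_isLevel_max_of_eq (k := k) (e := e) (n := n) (by omega)
      (by omega)
    exact ⟨I, hI, hIe, fun i hi => (hIi i hi).ge⟩
  · obtain ⟨b, rfl⟩ := Nat.exists_eq_add_of_le' hra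
    simp only [entryBound_of_lt (one_le_two.trans hr) hlt, Nat.add_sub_cancel]
    obtain ⟨I, hI, hIe, hIi⟩ := exists_isLevel_max_of_lt (k := k) hr he (b := b) (by omega)
      (by omega)
    exact ⟨I, hI, hIe, fun i hi => hIi i hi.le⟩

theorem isGreatest_maxHVector (k : Type*) [Field k] [Infinite k] (hr : 2 ≤ r) (he : 4 ≤ e)
    (hra : r ≤ a) (ha : a ≤ 2 * r) (hr5 : a = r → r ≤ 5) :
    IsGreatest {h : ℕ → ℕ | IsLevelHVector k r e 2 h ∧ h (e - 1) = a} (maxHVector r a e) := by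
  have hupper : ∀ I : Ideal (MvPolynomial (Fin r) k), IsLevel I e 2 → hVector I (e - 1) = a →
      hVector I ≤ maxHVector r a e := fun I hI hIe j => by
    by_cases hj : j < 2 ∨ e < j + 2
    · exact (hI.hVector_eq_maxHVector hIe hj).le
    · have hle := hI.hVector_le_entryBound hr he hIe hra hr5 (i := e - j) (by omega) (by omega)
      rw [← maxHVector_sub (by omega) (by omega)] at hle
      rwa [show e - (e - j) = j by omega] at hle
  refine ⟨?_, fun h => ?_⟩
  · obtain ⟨I, hI, hIe, hIi⟩ := exists_isLevel_entryBound_le (k := k) hr he hra ha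
    have heq : hVector I = maxHVector r a e := by
      refine (hupper I hI hIe).antisymm fun j => ?_
      by_cases hj : j < 2 ∨ e < j + 2
      · exact (hI.hVector_eq_maxHVector hIe hj).ge
      · have hle := hIi (e - j) (by omega)
        rw [← maxHVector_sub (by omega) (by omega)] at hle
        rwa [show e - (e - j) = j by omega] at hle
    exact ⟨⟨I, hI, heq⟩, heq ▸ hIe⟩
  · rintro ⟨⟨I, hI, rfl⟩, hIe⟩
    exact hupper I hI hIe

end MaxHVector

end LevelAlg

end

theorem theorem3p8_general (k : Type*) [Field k] [Infinite k] (r e : ℕ)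
    (hr : 2 ≤ r) (he : 4 ≤ e) :
    (r ≤ 5 → ∀ i : ℕ, 2 ≤ i → i ≤ e - 2 →
      (∀ h : ℕ → ℕ, IsLevelHVector k r e 2 h → h (e - 1) = r →
        h (e - i) = h i ∧
        h (e - i) ≤
          min ((r - 2 + i).choose i + 1) ((r - 2 + (e - i)).choose (e - i) + 1)) ∧
      (∀ v : ℕ, r ≤ v →
        v ≤ min ((r - 2 + i).choose i + 1) ((r - 2 + (e - i)).choose (e - i) + 1) →
        ∃ h : ℕ → ℕ, IsLevelHVector k r e 2 h ∧ h (e - 1) = r ∧ h (e - i) = v)) ∧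
    (∀ a : ℕ, r < a → a ≤ 2 * r → ∀ i : ℕ, 2 ≤ i → i ≤ e - 2 →
      (∀ h : ℕ → ℕ, IsLevelHVector k r e 2 h → h (e - 1) = a →
        h (e - i) ≤
          min ((r - 1 + i).choose i + (a - r - 1 + i).choose i)
            ((r - 1 + (e - i)).choose (e - i))) ∧
      (∀ v : ℕ, a ≤ v →
        v ≤ min ((r - 1 + i).choose i + (a - r - 1 + i).choose i)
            ((r - 1 + (e - i)).choose (e - i)) →
        ∃ h : ℕ → ℕ, IsLevelHVector k r e 2 h ∧ h (e - 1) = a ∧ h (e - i) = v)) ∧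
    (∀ a : ℕ, r ≤ a → a ≤ 2 * r → (a = r → r ≤ 5) →
      IsGreatest {h : ℕ → ℕ | IsLevelHVector k r e 2 h ∧ h (e - 1) = a}
        (maxHVector r a e)) := by
  have hself (i : ℕ) : entryBound r r e i = _ := if_pos rfl
  have hlt {a : ℕ} (ha : r < a) (i : ℕ) : entryBound r a e i = _ := if_neg ha.ne'
  refine ⟨fun hr5 i hi hie => ⟨?_, fun v hv hv' => ?_⟩,
    fun a ha ha2 i hi hie => ⟨?_, fun v hv hv' => ?_⟩,
    fun a => LevelAlg.isGreatest_maxHVector k hr he⟩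
  · rintro _ ⟨I, hI, rfl⟩ hIe
    exact ⟨hI.hVector_sub_eq he hr5 hIe (by omega) (by omega),
      (hI.hVector_le_entryBound hr he hIe le_rfl (fun _ => hr5) (by omega) (by omega)).trans_eq
        (hself i)⟩
  · obtain ⟨I, hI, hIe, hIv⟩ := LevelAlg.exists_isLevel_hVector_eq (k := k) hr he le_rfl (by omega)
      (by omega) (by omega) hv (hv'.trans_eq (hself i).symm)
    exact ⟨_, ⟨I, hI, rfl⟩, hIe, hIv⟩
  · rintro _ ⟨I, hI, rfl⟩ hIe
    exact (hI.hVector_le_entryBound hr he hIe ha.le (fun h => absurd h ha.ne') (by omega)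
      (by omega)).trans_eq (hlt ha i)
  · obtain ⟨I, hI, hIe, hIv⟩ := LevelAlg.exists_isLevel_hVector_eq (k := k) hr he ha.le ha2
      (by omega) (by omega) hv (hv'.trans_eq (hlt ha i).symm)
    exact ⟨_, ⟨I, hI, rfl⟩, hIe, hIv⟩

theorem theorem3p8 (k : Type*) [Field k] [CharZero k] (r e : ℕ) (hr : 2 ≤ r) (he : 4 ≤ e) :
    -- (i) the case `a = r ≤ 5`
    (r ≤ 5 → ∀ i : ℕ, 2 ≤ i → i ≤ e - 2 →
      (∀ h : ℕ → ℕ, IsLevelHVector k r e 2 h → h (e - 1) = r →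
        h (e - i) = h i ∧
        h (e - i) ≤
          min ((r - 2 + i).choose i + 1) ((r - 2 + (e - i)).choose (e - i) + 1)) ∧
      (∀ v : ℕ, r ≤ v →
        v ≤ min ((r - 2 + i).choose i + 1) ((r - 2 + (e - i)).choose (e - i) + 1) →
        ∃ h : ℕ → ℕ, IsLevelHVector k r e 2 h ∧ h (e - 1) = r ∧ h (e - i) = v)) ∧
    -- (ii) the case `r < a ≤ 2r`
    (∀ a : ℕ, r < a → a ≤ 2 * r → ∀ i : ℕ, 2 ≤ i → i ≤ e - 2 →
      (∀ h : ℕ → ℕ, IsLevelHVector k r e 2 h → h (e - 1) = a →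
        h (e - i) ≤
          min ((r - 1 + i).choose i + (a - r - 1 + i).choose i)
            ((r - 1 + (e - i)).choose (e - i))) ∧
      (∀ v : ℕ, a ≤ v →
        v ≤ min ((r - 1 + i).choose i + (a - r - 1 + i).choose i)
            ((r - 1 + (e - i)).choose (e - i)) →
        ∃ h : ℕ → ℕ, IsLevelHVector k r e 2 h ∧ h (e - 1) = a ∧ h (e - i) = v)) ∧
    -- (iii) all the upper bounds are attained simultaneously, by the entrywise greatest `h`-vector
    (∀ a : ℕ, r ≤ a → a ≤ 2 * r → (a = r → r ≤ 5) →
      IsGreatest {h : ℕ → ℕ | IsLevelHVector k r e 2 h ∧ h (e - 1) = a}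
        (maxHVector r a e)) :=
  theorem3p8_general k r e hr he
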